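/- For $k\in\mathbb Z$ let $\psi_k(x)=e^{2\pi i(k+\frac12)x}\in L^2([0,1])$. For $s\in\mathbb R$ let $H^s_{1/2}$ be the Hilbert space of (generalized) functions $f=\sum_{k}\langle f,\psi_k\rangle\psi_k$ with $$\|f\|_{H^s_{1/2}}^2=\sum_{k\in\mathbb Z}\bigl(1+|k+\tfrac12|^2\bigr)^s\,|\langle f,\psi_k\rangle|^2<\infty ,$$ where for $s<0$ the series is a formal one (a conjugate-linear functional on $\operatorname{span}\{\psi_k\}$). Let $\widetilde A$ be the unbounded operator on $H^s_{1/2}$ with domain $H^{s+1}_{1/2}$ given by $\widetilde A f=\sum_k (k+\tfrac12)\langle f,\psi_k\rangle\psi_k$. **Theorem.** Let $s\in\mathbb R$ and let $(B_t)_{t\in[0,1]}$ be a norm-continuous family of bounded self-adjoint operators on the Hilbert space $H^s_{1/2}$. Put $\widetilde A_t=\widetilde A+B_t$ with domain $H^{s+1}_{1/2}\subset H^s_{1/2}$. Then every $\widetilde A_t$ is self-adjoint on $H^s_{1/2}$ and has compact resolvent, and the spectral flow $\operatorname{sf}\{\widetilde A_t\}_{t\in[0,1]}$ is well defined as the signed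 count of eigenvalue crossings through zero, in the following sense. 1. There are a partition $0=t_0<\dots<t_n=1$ and numbers $\varepsilon_1,\dots,\varepsilon_n>0$ such that $\pm\varepsilon_i\notin\sigma(\widetilde A_t)$ for all $t\in[t_{i-1},t_i]$ and all $i$. 2. For every such choice and every $i$ there are finitely many continuous functions $\lambda_{i,1},\dots,\lambda_{i,m_i}:[t_{i-1},t_i]\to(-\varepsilon_i,\varepsilon_i)$ which list, for each $t$, all eigenvalues of $\widetilde A_t$ in $(-\varepsilon_i,\varepsilon_i)$, each as often as its multiplicity. 3. The integer $$\sum_{i=1}^n\Bigl(\#\{l:\lambda_{i,l}(t_{i-1})<0\le\lambda_{i,l}(t_i)\}-\#\{l:\lambda_{i,l}(t_{i-1})\ge 0>\lambda_{i,l}(t_i)\}\Bigr)$$ is the same for all choices of the partition, of the $\varepsilon_i$ and of the functions $\lambda_{i,l}$. This integer is $\operatorname{sf}\{\widetilde A_t\}_{t\in[0,1]}$. -/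

import Mathlib

open MeasureTheory Set
open scoped ENNReal

noncomputable section

/-! ### Half-integer modes on the unit interval -/

/-- The Hilbert space `L²([0,1], dx)`. -/
abbrev L2UnitInterval : Type :=
  Lp ℂ 2 ((volume : Measure ℝ).restrict (Icc (0 : ℝ) 1))

/-- The mode `x ↦ e^{π i x} e^{2π i k x}`: the standard Fourier mode, multiplied by the twist
`e^{π i x}`. -/
def twistedModeFun (k : ℤ) (x : ℝ) : ℂ :=
  Complex.exp (Real.pi * Complex.I * x) * Complex.exp (2 * Real.pi * Complex.I * k * x)

theorem twistedModeFun_eq (k : ℤ) (x : ℝ) :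
    twistedModeFun k x = Complex.exp (2 * Real.pi * Complex.I * (k + 1 / 2) * x) := by
  rw [twistedModeFun, ← Complex.exp_add]
  congr 1
  ring

theorem continuous_twistedModeFun (k : ℤ) : Continuous (twistedModeFun k) := by
  unfold twistedModeFun
  fun_prop

theorem memLp_twistedModeFun (k : ℤ) :
    MemLp (twistedModeFun k) 2 ((volume : Measure ℝ).restrict (Icc (0 : ℝ) 1)) := by
  refine MemLp.of_bound (continuous_twistedModeFun k).aestronglyMeasurable 1 ?_
  refine Filter.Eventually.of_forall fun x => ?_
  rw [twistedModeFun, norm_mul, Complex.norm_exp, Complex.norm_exp]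
  simp

/-- The mode `ψ_k` as an element of `L²([0,1])`. -/
def twistedMode (k : ℤ) : L2UnitInterval := (memLp_twistedModeFun k).toLp

theorem inner_twistedMode (j k : ℤ) :
    inner ℂ (twistedMode j) (twistedMode k) = if j = k then (1 : ℂ) else 0 := by
  have h1 : inner ℂ (twistedMode j) (twistedMode k) =
      ∫ x in (0 : ℝ)..1, Complex.exp ((2 * Real.pi * Complex.I * ((k : ℂ) - j)) * x) := by
    rw [L2.inner_def, intervalIntegral.integral_of_le zero_le_one,
      ← integral_Icc_eq_integral_Ioc]
    refine integral_congr_ae ?_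
    filter_upwards [(memLp_twistedModeFun j).coeFn_toLp, (memLp_twistedModeFun k).coeFn_toLp]
      with x hj hk
    rw [twistedMode, twistedMode, hj, hk, RCLike.inner_apply, twistedModeFun_eq,
      twistedModeFun_eq, ← Complex.exp_conj, ← Complex.exp_add]
    congr 1
    simp only [map_mul, map_add, map_div₀, Complex.conj_I, Complex.conj_ofReal, map_ofNat,
      map_one, map_intCast]
    ring
  rw [h1]
  split_ifs with h
  · subst h
    simp
  · have hc : (2 * Real.pi * Complex.I * ((k : ℂ) - j)) ≠ 0 := by
      have : ((k : ℂ) - j) ≠ 0 := by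
        rw [sub_ne_zero]
        exact_mod_cast Ne.symm h
      have hp : (Real.pi : ℂ) ≠ 0 := by exact_mod_cast Real.pi_ne_zero
      simp [this, hp, Complex.I_ne_zero]
    rw [integral_exp_mul_complex hc]
    have : Complex.exp (2 * Real.pi * Complex.I * ((k : ℂ) - j) * (1 : ℝ)) = 1 := by
      rw [Complex.exp_eq_one_iff]
      exact ⟨k - j, by push_cast; ring⟩
    rw [this]
    simp

theorem orthonormal_twistedMode : Orthonormal ℂ twistedMode :=
  orthonormal_iff_ite.mpr inner_twistedMode

/-! ### Generalized functions and the twisted Fourier map -/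

/-- Finite linear combinations of the modes `ψ_k`. -/
abbrev TwistedPoly : Submodule ℂ L2UnitInterval := Submodule.span ℂ (range twistedMode)

/-- The modes as a basis of `TwistedPoly`. -/
def twistedBasis : Module.Basis ℤ ℂ TwistedPoly :=
  Module.Basis.span orthonormal_twistedMode.linearIndependent

theorem twistedBasis_apply (k : ℤ) : (twistedBasis k : L2UnitInterval) = twistedMode k :=
  congrArg Subtype.val (Module.Basis.span_apply orthonormal_twistedMode.linearIndependent k)

/-- Generalized functions: conjugate-linear functionals `φ ↦ ⟨f, φ⟩` on the finite linear
combinations of the modes (equivalently, formal series `∑ a_k ψ_k`). They are needed because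
`H^s` is not contained in `L²` for `s < 0`. -/
abbrev TwistedGenFun : Type := TwistedPoly →ₛₗ[starRingEnd ℂ] ℂ

/-- A function `f ∈ L²([0,1])` seen as the generalized function `φ ↦ ∫ f φ̄`. -/
def TwistedGenFun.ofL2 : L2UnitInterval →ₗ[ℂ] TwistedGenFun where
  toFun f :=
    { toFun := fun φ => inner ℂ (φ : L2UnitInterval) f
      map_add' := fun φ χ => by simp [inner_add_left]
      map_smul' := fun c φ => by simp [inner_smul_left] }
  map_add' f g := by ext φ; simp [inner_add_right]
  map_smul' c f := by ext φ; simp [inner_smul_right]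

/-- The twisted Fourier map `f ↦ (⟨f, ψ_k⟩)_k`, on generalized functions. -/
def twistedFourier : TwistedGenFun ≃ₗ[ℂ] (ℤ → ℂ) where
  toFun f k := f (twistedBasis k)
  map_add' f g := rfl
  map_smul' c f := rfl
  invFun a :=
    { toFun := fun φ => starRingEnd ℂ (twistedBasis.constr ℂ (fun k => starRingEnd ℂ (a k)) φ)
      map_add' := fun φ χ => by simp
      map_smul' := fun c φ => by simp }
  left_inv f := by
    have h : (starLinearEquiv ℂ (A := ℂ)).toLinearMap.comp f =
        twistedBasis.constr ℂ (fun k => starRingEnd ℂ (f (twistedBasis k))) := by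
      refine twistedBasis.ext fun k => ?_
      simp [Module.Basis.constr_basis]
    ext φ
    have h2 := LinearMap.congr_fun h φ
    change starRingEnd ℂ (twistedBasis.constr ℂ _ φ) = f φ
    rw [← h2]
    simp
  right_inv a := by
    funext k
    simp [Module.Basis.constr_basis]

theorem twistedFourier_ofL2 (f : L2UnitInterval) (k : ℤ) :
    twistedFourier (TwistedGenFun.ofL2 f) k = inner ℂ (twistedMode k) f := by
  simp [twistedFourier, TwistedGenFun.ofL2, twistedBasis_apply]

/-! ### The weighted scale -/

/-- The weight `1 + |k + 1/2|²`. -/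
def twistedWeight (k : ℤ) : ℝ := 1 + |(k : ℝ) + 1 / 2| ^ 2

theorem twistedWeight_pos (k : ℤ) : 0 < twistedWeight k := by
  unfold twistedWeight
  positivity

/-- The space `ℓ²_s(ℤ)` of sequences with `∑ (1 + |k + 1/2|²)^s |a_k|² < ∞`. -/
def weightedEll2 (s : ℝ) : Submodule ℂ (ℤ → ℂ) where
  carrier := {a | Summable fun k => twistedWeight k ^ s * ‖a k‖ ^ 2}
  zero_mem' := by simp [summable_zero]
  add_mem' := by
    intro a b ha hb
    refine Summable.of_nonneg_of_le (fun k => ?_) (fun k => ?_) ((ha.add hb).mul_left 2)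
    · exact mul_nonneg (Real.rpow_nonneg (twistedWeight_pos k).le _) (sq_nonneg _)
    · have hw : 0 ≤ twistedWeight k ^ s := Real.rpow_nonneg (twistedWeight_pos k).le _
      have h1 : ‖a k + b k‖ ^ 2 ≤ 2 * (‖a k‖ ^ 2 + ‖b k‖ ^ 2) := by
        have h2 := norm_add_le (a k) (b k)
        nlinarith [sq_nonneg (‖a k‖ - ‖b k‖), norm_nonneg (a k + b k), norm_nonneg (a k),
          norm_nonneg (b k)]
      calc twistedWeight k ^ s * ‖(a + b) k‖ ^ 2
          ≤ twistedWeight k ^ s * (2 * (‖a k‖ ^ 2 + ‖b k‖ ^ 2)) :=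
            mul_le_mul_of_nonneg_left h1 hw
        _ = _ := by ring
  smul_mem' := by
    intro c a ha
    refine (ha.mul_left (‖c‖ ^ 2)).congr fun k => ?_
    simp only [Pi.smul_apply, smul_eq_mul, norm_mul]
    ring

theorem mem_weightedEll2 {s : ℝ} {a : ℤ → ℂ} :
    a ∈ weightedEll2 s ↔ Summable fun k => twistedWeight k ^ s * ‖a k‖ ^ 2 := Iff.rfl

/-- `H^s_{1/2}` as a set of generalized functions: the preimage of `ℓ²_s(ℤ)` under the twisted
Fourier map. -/
def twistedSobolevSubmodule (s : ℝ) : Submodule ℂ TwistedGenFun :=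
  (weightedEll2 s).comap twistedFourier.toLinearMap

/-- The Hilbert space `H^s_{1/2}`. -/
def TwistedSobolev (s : ℝ) : Type := twistedSobolevSubmodule s

namespace TwistedSobolev

variable {s : ℝ}

instance : AddCommGroup (TwistedSobolev s) :=
  inferInstanceAs (AddCommGroup (twistedSobolevSubmodule s))

instance : Module ℂ (TwistedSobolev s) :=
  inferInstanceAs (Module ℂ (twistedSobolevSubmodule s))

/-- The inclusion of `H^s_{1/2}` into generalized functions. -/
def incl (s : ℝ) : TwistedSobolev s →ₗ[ℂ] TwistedGenFun := (twistedSobolevSubmodule s).subtype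

/-- The coefficients `k ↦ ⟨f, ψ_k⟩` of an element of `H^s_{1/2}`. -/
def coeff (s : ℝ) : TwistedSobolev s →ₗ[ℂ] (ℤ → ℂ) := twistedFourier.toLinearMap ∘ₗ incl s

theorem coeff_mem (f : TwistedSobolev s) : coeff s f ∈ weightedEll2 s := f.2

theorem coeff_injective : Function.Injective (coeff s) :=
  twistedFourier.injective.comp Subtype.val_injective

/-- The element of `H^s_{1/2}` with prescribed coefficients. -/
def ofCoeff (a : ℤ → ℂ) (ha : a ∈ weightedEll2 s) : TwistedSobolev s :=
  ⟨twistedFourier.symm a, by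
    simpa [twistedSobolevSubmodule] using ha⟩

theorem coeff_ofCoeff (a : ℤ → ℂ) (ha : a ∈ weightedEll2 s) : coeff s (ofCoeff a ha) = a :=
  twistedFourier.apply_symm_apply a

theorem norm_sq_weighted (s : ℝ) (k : ℤ) (z : ℂ) :
    ‖((twistedWeight k ^ (s / 2) : ℝ) : ℂ) * z‖ ^ 2 = twistedWeight k ^ s * ‖z‖ ^ 2 := by
  have hw := (twistedWeight_pos k).le
  rw [norm_mul, Complex.norm_real, Real.norm_of_nonneg (Real.rpow_nonneg hw _), mul_pow,
    ← Real.rpow_natCast (twistedWeight k ^ (s / 2)) 2, ← Real.rpow_mul hw]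
  norm_num

/-- The map `f ↦ ((1 + |k + 1/2|²)^{s/2} ⟨f, ψ_k⟩)_k` into `ℓ²(ℤ)`, a linear bijection. Norm and
inner product of `H^s_{1/2}` are those for which it is unitary. -/
def toEll2 (s : ℝ) : TwistedSobolev s ≃ₗ[ℂ] lp (fun _ : ℤ => ℂ) 2 where
  toFun f := ⟨fun k => ((twistedWeight k ^ (s / 2) : ℝ) : ℂ) * coeff s f k, by
    refine memℓp_gen ?_
    refine (coeff_mem f).congr fun k => ?_
    simpa using (norm_sq_weighted s k (coeff s f k)).symm⟩
  map_add' f g := by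
    ext k
    change _ * coeff s (f + g) k = _ * coeff s f k + _ * coeff s g k
    rw [map_add, Pi.add_apply, mul_add]
  map_smul' c f := by
    ext k
    change _ * coeff s (c • f) k = c * (_ * coeff s f k)
    rw [map_smul, Pi.smul_apply, smul_eq_mul, mul_left_comm]
  invFun a := ofCoeff (fun k => ((twistedWeight k ^ (s / 2) : ℝ) : ℂ)⁻¹ * a k) (by
    have h := (lp.memℓp a).summable (by norm_num)
    refine h.congr fun k => ?_
    have hne : ((twistedWeight k ^ (s / 2) : ℝ) : ℂ) ≠ 0 := by
      exact_mod_cast (Real.rpow_pos_of_pos (twistedWeight_pos k) _).ne'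
    rw [← norm_sq_weighted, mul_inv_cancel_left₀ hne]
    simp)
  left_inv f := by
    refine coeff_injective ((coeff_ofCoeff _ _).trans ?_)
    funext k
    have hne : ((twistedWeight k ^ (s / 2) : ℝ) : ℂ) ≠ 0 := by
      exact_mod_cast (Real.rpow_pos_of_pos (twistedWeight_pos k) _).ne'
    exact inv_mul_cancel_left₀ hne _
  right_inv a := by
    ext k
    have hne : ((twistedWeight k ^ (s / 2) : ℝ) : ℂ) ≠ 0 := by
      exact_mod_cast (Real.rpow_pos_of_pos (twistedWeight_pos k) _).ne'
    exact (congrArg (_ * ·) (congrFun (coeff_ofCoeff _ _) k)).trans (mul_inv_cancel_left₀ hne _)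

theorem toEll2_apply (f : TwistedSobolev s) (k : ℤ) :
    toEll2 s f k = ((twistedWeight k ^ (s / 2) : ℝ) : ℂ) * coeff s f k := rfl

instance : NormedAddCommGroup (TwistedSobolev s) :=
  NormedAddCommGroup.induced _ _ (toEll2 s).toLinearMap (toEll2 s).injective

instance : InnerProductSpace ℂ (TwistedSobolev s) where
  norm_smul_le c f := by
    change ‖toEll2 s (c • f)‖ ≤ ‖c‖ * ‖toEll2 s f‖
    rw [map_smul, norm_smul]
  inner f g := inner ℂ (toEll2 s f) (toEll2 s g)
  norm_sq_eq_re_inner f := norm_sq_eq_re_inner (𝕜 := ℂ) (toEll2 s f)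
  conj_inner_symm f g := inner_conj_symm (toEll2 s f) (toEll2 s g)
  add_left f g h := by rw [map_add, inner_add_left]
  smul_left f g c := by rw [map_smul, inner_smul_left]

/-- The unitary isomorphism of `H^s_{1/2}` with `ℓ²(ℤ)`. -/
def toEll2Isometry (s : ℝ) : TwistedSobolev s ≃ₗᵢ[ℂ] lp (fun _ : ℤ => ℂ) 2 where
  toLinearEquiv := toEll2 s
  norm_map' _ := rfl

instance : CompleteSpace (TwistedSobolev s) :=
  (toEll2Isometry s).toIsometryEquiv.completeSpace

theorem norm_sq_eq (f : TwistedSobolev s) :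
    ‖f‖ ^ 2 = ∑' k : ℤ, twistedWeight k ^ s * ‖coeff s f k‖ ^ 2 := by
  have h := lp.norm_rpow_eq_tsum (p := 2) (by norm_num) (toEll2 s f)
  have h2 : ‖f‖ = ‖toEll2 s f‖ := rfl
  rw [h2]
  simp only [ENNReal.toReal_ofNat, Real.rpow_two, toEll2_apply, norm_sq_weighted] at h
  exact h

end TwistedSobolev

/-! ### The canonical diagonal operator and its perturbations -/

/-- Multiplication of sequences by `k + 1/2`. -/
def halfIntegerMul : (ℤ → ℂ) →ₗ[ℂ] (ℤ → ℂ) where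
  toFun a k := ((k : ℂ) + 1 / 2) * a k
  map_add' a b := by funext k; simp [mul_add]
  map_smul' c a := by funext k; simp [mul_left_comm]

theorem halfIntegerMul_mem {s : ℝ} {a : ℤ → ℂ} (ha : a ∈ weightedEll2 (s + 1)) :
    halfIntegerMul a ∈ weightedEll2 s := by
  refine Summable.of_nonneg_of_le (fun k => ?_) (fun k => ?_) (mem_weightedEll2.mp ha)
  · exact mul_nonneg (Real.rpow_nonneg (twistedWeight_pos k).le _) (sq_nonneg _)
  · have hn : ‖(k : ℂ) + 1 / 2‖ = |(k : ℝ) + 1 / 2| := by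
      rw [← Real.norm_eq_abs, ← Complex.norm_real]
      push_cast
      rfl
    change twistedWeight k ^ s * ‖((k : ℂ) + 1 / 2) * a k‖ ^ 2 ≤ _
    rw [norm_mul, hn, mul_pow, Real.rpow_add (twistedWeight_pos k), Real.rpow_one, mul_assoc]
    refine mul_le_mul_of_nonneg_left ?_ (Real.rpow_nonneg (twistedWeight_pos k).le _)
    refine mul_le_mul_of_nonneg_right ?_ (sq_nonneg _)
    unfold twistedWeight
    linarith

/-- The operator `Ã = F⁻¹ ∘ A ∘ F` as an unbounded operator on `H^s_{1/2}`, with domain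
`H^{s+1}_{1/2}`. -/
def twistedOperator (s : ℝ) : TwistedSobolev s →ₗ.[ℂ] TwistedSobolev s where
  domain := (twistedSobolevSubmodule (s + 1)).comap (TwistedSobolev.incl s)
  toFun :=
    { toFun := fun f => TwistedSobolev.ofCoeff (halfIntegerMul (TwistedSobolev.coeff s f))
        (halfIntegerMul_mem f.2)
      map_add' := fun f g => by
        refine TwistedSobolev.coeff_injective ?_
        simp only [map_add, TwistedSobolev.coeff_ofCoeff, Submodule.coe_add]
      map_smul' := fun c f => by
        refine TwistedSobolev.coeff_injective ?_
        simp only [map_smul, TwistedSobolev.coeff_ofCoeff, Submodule.coe_smul, RingHom.id_apply] }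

/-- The perturbed operator `Ã + B`, with domain `H^{s+1}_{1/2}`. -/
def perturbedOperator (s : ℝ) (B : TwistedSobolev s →L[ℂ] TwistedSobolev s) :
    TwistedSobolev s →ₗ.[ℂ] TwistedSobolev s where
  domain := (twistedOperator s).domain
  toFun := (twistedOperator s).toFun + B.toLinearMap ∘ₗ (twistedOperator s).domain.subtype

/-! ### Spectral notions for unbounded operators -/

section Spectral

variable {E : Type*} [NormedAddCommGroup E] [InnerProductSpace ℂ E]

/-- `R` is the bounded everywhere defined inverse of `T - z : D(T) → E`. -/
def IsResolventAt (T : E →ₗ.[ℂ] E) (z : ℂ) (R : E →L[ℂ] E) : Prop :=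
  (∀ y : E, ∃ h : R y ∈ T.domain, T ⟨R y, h⟩ - z • R y = y) ∧
    ∀ x : T.domain, R (T x - z • (x : E)) = x

/-- The resolvent set of an unbounded operator. -/
def unboundedResolventSet (T : E →ₗ.[ℂ] E) : Set ℂ := {z | ∃ R, IsResolventAt T z R}

/-- The resolvent set is nonempty and every resolvent is a compact operator. -/
def HasCompactResolvent (T : E →ₗ.[ℂ] E) : Prop :=
  (unboundedResolventSet T).Nonempty ∧ ∀ z R, IsResolventAt T z R → IsCompactOperator R

/-- The eigenspace `ker (T - μ)`. -/
def unboundedEigenspace (T : E →ₗ.[ℂ] E) (μ : ℂ) : Submodule ℂ E :=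
  (LinearMap.ker (T.toFun - μ • T.domain.subtype)).map T.domain.subtype

/-- A partition `0 = t_0 < ⋯ < t_n = 1` with levels `ε_i > 0` such that neither `ε_i` nor `-ε_i`
is in the spectrum of `T_t` for `t` in the `i`-th subinterval. -/
structure SpectralGrid (T : unitInterval → E →ₗ.[ℂ] E) where
  n : ℕ
  t : Fin (n + 1) → unitInterval
  strictMono : StrictMono t
  t_zero : t 0 = 0
  t_last : t (Fin.last n) = 1
  ε : Fin n → ℝ
  ε_pos : ∀ i, 0 < ε i
  gap : ∀ i, ∀ τ ∈ Icc (t i.castSucc) (t i.succ),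
    (ε i : ℂ) ∈ unboundedResolventSet (T τ) ∧ (-(ε i : ℂ)) ∈ unboundedResolventSet (T τ)

/-- Continuous branches of the eigenvalues in the windows `(-ε_i, ε_i)` of a grid: on the `i`-th
subinterval, finitely many continuous functions which list at every time all the eigenvalues in
`(-ε_i, ε_i)`, each as often as its multiplicity. -/
structure EigenvalueBranches {T : unitInterval → E →ₗ.[ℂ] E} (G : SpectralGrid T) where
  m : Fin G.n → ℕ
  branch : (i : Fin G.n) → Fin (m i) → unitInterval → ℝ
  continuousOn : ∀ i l, ContinuousOn (branch i l) (Icc (G.t i.castSucc) (G.t i.succ))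
  mem_window : ∀ i l, ∀ τ ∈ Icc (G.t i.castSucc) (G.t i.succ),
    branch i l τ ∈ Ioo (-G.ε i) (G.ε i)
  multiplicity : ∀ i, ∀ τ ∈ Icc (G.t i.castSucc) (G.t i.succ), ∀ μ ∈ Ioo (-G.ε i) (G.ε i),
    Module.rank ℂ (unboundedEigenspace (T τ) (μ : ℂ)) =
      ((Finset.univ.filter fun l => branch i l τ = μ).card : Cardinal)

/-- The signed count of crossings through zero: over all subintervals, the number of branches that
pass from negative to nonnegative values, minus the number of those that pass from nonnegative to
negative values. -/
def EigenvalueBranches.signedCount {T : unitInterval → E →ₗ.[ℂ] E} {G : SpectralGrid T}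
    (b : EigenvalueBranches G) : ℤ :=
  ∑ i : Fin G.n,
    (((Finset.univ.filter fun l =>
        b.branch i l (G.t i.castSucc) < 0 ∧ 0 ≤ b.branch i l (G.t i.succ)).card : ℤ) -
      ((Finset.univ.filter fun l =>
        0 ≤ b.branch i l (G.t i.castSucc) ∧ b.branch i l (G.t i.succ) < 0).card : ℤ))

end Spectral

end

/-! In the orthonormal basis of normalised modes, the unperturbed operator is diagonal with entries
`d k = k + 1/2`. Zero is not an entry and the entries tend to infinity in modulus, so its inverse
`K` is compact and self-adjoint. On the range of `K` the perturbed operator is `K y ↦ y + B (K y)`.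
Self-adjointness and compactness of every resolvent follow from this form alone
(`IsPerturbedInverse`).

The core is a labelling of all eigenvalues by `ℤ` that is continuous in `t` on the whole of `[0,1]`.
Compress the operator to the span of finitely many modes and list its eigenvalues in increasing
order, indexed by those modes. Weyl's inequality bounds the `k`-th eigenvalues for `B` and `B'` to
within `‖B - B'‖` of each other, and the one for `B` to within `‖B‖` of `d k`, uniformly in the
truncation. Let the truncations grow along one ultrafilter, the same for every `B`: the eigenvalues
converge, and both bounds survive. Compactness of `K` makes the eigenvectors converge in norm, and a
tail estimate shows that the limits span a dense subspace (`HilbertBasis.exists_eigenbasis`).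

With such a labelling `l` the rest is counting. Only finitely many labels ever meet a bounded
window, so grids and branches exist. On a grid interval, labels outside the window cannot change
sign, and any choice of branches takes the same values, with multiplicity, as the labels inside. The
signed count therefore telescopes to the sum over `k` of the change of the indicator of `l k ≥ 0`
between times `0` and `1`, which involves no choices
(`IsEigenvalueLabelling.signedCount_eq_finsum`). -/

noncomputable section

open Filter Topology InnerProductSpace

/-! ### Diagonal operators in a Hilbert basis -/

section DiagonalOperators

variable {ι H : Type*} [NormedAddCommGroup H] [InnerProductSpace ℂ H]

theorem HilbertBasis.ext_inner (b : HilbertBasis ι ℂ H) {x y : H}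
    (h : ∀ i, inner ℂ (b i) x = inner ℂ (b i) y) : x = y := by
  apply b.repr.injective
  ext i
  rw [b.repr_apply_apply, b.repr_apply_apply, h]

theorem HilbertBasis.clm_ext (b : HilbertBasis ι ℂ H) {F : Type*} [NormedAddCommGroup F]
    [NormedSpace ℂ F] {S T : H →L[ℂ] F} (h : ∀ i, S (b i) = T (b i)) : S = T := by
  refine ContinuousLinearMap.ext_on (s := range b) ?_ ?_
  · rw [dense_iff_closure_eq, ← Submodule.topologicalClosure_coe, b.dense_span]
    rfl
  · rintro _ ⟨i, rfl⟩
    exact h i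

/-- A bounded family of numbers defines a bounded diagonal operator in a Hilbert basis. -/
theorem HilbertBasis.exists_diagonal (b : HilbertBasis ι ℂ H) (c : ι → ℂ) {C : ℝ} (hC : 0 ≤ C)
    (hc : ∀ i, ‖c i‖ ≤ C) :
    ∃ D : H →L[ℂ] H, ‖D‖ ≤ C ∧ ∀ x i, inner ℂ (b i) (D x) = c i * inner ℂ (b i) x := by
  have hT : ∀ i, ‖(c i • ContinuousLinearMap.id ℂ ℂ : ℂ →L[ℂ] ℂ)‖ ≤ C := fun i => by
    rw [norm_smul, ContinuousLinearMap.norm_id, mul_one]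
    exact hc i
  let M := lp.mapCLM (E := fun _ : ι => ℂ) (F := fun _ : ι => ℂ) 2 _ hC hT
  refine ⟨b.repr.symm.toContinuousLinearEquiv.toContinuousLinearMap.comp
    (M.comp b.repr.toContinuousLinearEquiv.toContinuousLinearMap), ?_, fun x i => ?_⟩
  · refine ContinuousLinearMap.opNorm_le_bound _ hC fun x => ?_
    change ‖b.repr.symm (M (b.repr x))‖ ≤ _
    rw [LinearIsometryEquiv.norm_map]
    refine (M.le_of_opNorm_le (lp.norm_mapCLM_le _ _ hC hT) _).trans ?_
    rw [LinearIsometryEquiv.norm_map]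
  · rw [← b.repr_apply_apply, ← b.repr_apply_apply]
    change b.repr (b.repr.symm (M (b.repr x))) i = _
    rw [LinearIsometryEquiv.apply_symm_apply]
    simp [M]

/-- `D` acts as multiplication by `c` on the coordinates with respect to `b`. -/
def HilbertBasis.IsDiagonal (b : HilbertBasis ι ℂ H) (c : ι → ℂ) (D : H →L[ℂ] H) : Prop :=
  ∀ x i, inner ℂ (b i) (D x) = c i * inner ℂ (b i) x

theorem HilbertBasis.inner_self_eq_ite [DecidableEq ι] (b : HilbertBasis ι ℂ H) (i j : ι) :
    inner ℂ (b i) (b j) = if i = j then (1 : ℂ) else 0 :=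
  orthonormal_iff_ite.mp b.orthonormal i j

theorem HilbertBasis.IsDiagonal.apply_basis {b : HilbertBasis ι ℂ H} {c : ι → ℂ} {D : H →L[ℂ] H}
    (hD : b.IsDiagonal c D) (i : ι) : D (b i) = c i • b i := by
  classical
  refine b.ext_inner fun j => ?_
  rw [hD, inner_smul_right, b.inner_self_eq_ite]
  split_ifs with h <;> simp [h]

theorem HilbertBasis.IsDiagonal.isSelfAdjoint [CompleteSpace H] {b : HilbertBasis ι ℂ H}
    {c : ι → ℂ} {D : H →L[ℂ] H} (hD : b.IsDiagonal c D)
    (hc : ∀ i, starRingEnd ℂ (c i) = c i) : IsSelfAdjoint D := by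
  rw [ContinuousLinearMap.isSelfAdjoint_iff']
  refine ContinuousLinearMap.ext fun x => b.ext_inner fun i => ?_
  rw [ContinuousLinearMap.adjoint_inner_right, hD.apply_basis, inner_smul_left, hc, hD]

/-- The finite-rank diagonal operator with entries `c i` for `i ∈ s` and zero otherwise. -/
def HilbertBasis.finDiagonal (b : HilbertBasis ι ℂ H) (c : ι → ℂ) (s : Finset ι) : H →L[ℂ] H :=
  ∑ i ∈ s, (ContinuousLinearMap.toSpanSingleton ℂ (c i • b i)).comp (innerSL ℂ (b i))

theorem HilbertBasis.finDiagonal_apply (b : HilbertBasis ι ℂ H) (c : ι → ℂ) (s : Finset ι)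
    (x : H) : b.finDiagonal c s x = ∑ i ∈ s, inner ℂ (b i) x • c i • b i := by
  simp [finDiagonal]

theorem HilbertBasis.isDiagonal_finDiagonal [DecidableEq ι] (b : HilbertBasis ι ℂ H) (c : ι → ℂ)
    (s : Finset ι) : b.IsDiagonal (fun i => if i ∈ s then c i else 0) (b.finDiagonal c s) := by
  intro x i
  simp only [finDiagonal_apply, inner_sum, inner_smul_right, b.inner_self_eq_ite]
  simp [mul_comm]

theorem HilbertBasis.isCompactOperator_finDiagonal (b : HilbertBasis ι ℂ H) (c : ι → ℂ)
    (s : Finset ι) : IsCompactOperator (b.finDiagonal c s) := by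
  refine (compactOperator (RingHom.id ℂ) H H).sum_mem (t := s)
    (f := fun i => (ContinuousLinearMap.toSpanSingleton ℂ (c i • b i)).comp (innerSL ℂ (b i)))
    fun i _ => ?_
  have h : IsCompactOperator (innerSL ℂ (b i)) :=
    isCompactOperator_of_locallyCompactSpace_dom (innerSL ℂ (b i))
  exact h.clm_comp (ContinuousLinearMap.toSpanSingleton ℂ (c i • b i))

/-- A diagonal operator whose entries tend to zero is compact. -/
theorem HilbertBasis.IsDiagonal.isCompactOperator [CompleteSpace H] {b : HilbertBasis ι ℂ H}
    {c : ι → ℂ} {D : H →L[ℂ] H} (hD : b.IsDiagonal c D)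
    (hc : ∀ r > 0, {i | r < ‖c i‖}.Finite) : IsCompactOperator D := by
  classical
  refine isCompactOperator_of_tendsto (l := atTop) (F := b.finDiagonal c) ?_
    (Eventually.of_forall (b.isCompactOperator_finDiagonal c))
  rw [Metric.tendsto_atTop]
  intro r hr
  refine ⟨(hc (r / 2) (by positivity)).toFinset, fun s hs => ?_⟩
  -- The error of the finite-rank truncation is itself diagonal. Its nonzero entries lie off `s`,
  -- where `‖c i‖ ≤ r / 2`.
  obtain ⟨G, hGn, hG⟩ := b.exists_diagonal (fun i => if i ∈ s then 0 else -c i)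
    (C := r / 2) (by positivity) (fun i => by
      split_ifs with h
      · simpa using by positivity
      · rw [norm_neg]
        by_contra! hlt
        exact h (hs (by simpa using hlt)))
  have hFG : b.finDiagonal c s - D = G := by
    refine ContinuousLinearMap.ext fun x => b.ext_inner fun i => ?_
    rw [hG, _root_.sub_apply, inner_sub_right, b.isDiagonal_finDiagonal c s, hD]
    split_ifs with h <;> simp [h]
  rw [dist_eq_norm, hFG]
  linarith

end DiagonalOperators

/-! ### Eigenvalue comparison in finite dimension -/

section Weyl

variable {E ι : Type*} [NormedAddCommGroup E] [InnerProductSpace ℂ E] [Fintype ι]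

theorem OrthonormalBasis.re_inner_apply_self (u : OrthonormalBasis ι ℂ E)
    {S : E →ₗ[ℂ] E} (hS : S.IsSymmetric) {a : ι → ℝ} (ha : ∀ i, S (u i) = (a i : ℂ) • u i)
    (x : E) : (inner ℂ x (S x)).re = ∑ i, a i * ‖inner ℂ (u i) x‖ ^ 2 := by
  rw [← u.sum_inner_mul_inner, Complex.re_sum]
  refine Finset.sum_congr rfl fun i _ => ?_
  rw [← hS (u i) x, ha, inner_smul_left, Complex.conj_ofReal, mul_left_comm, Complex.re_ofReal_mul,
    ← inner_conj_symm x (u i), ← Complex.normSq_eq_conj_mul_self, Complex.ofReal_re,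
    Complex.normSq_eq_norm_sq]

/-- **Weyl's inequality** for eigenvalues listed in increasing order. -/
theorem OrthonormalBasis.eigenvalue_le_add [LinearOrder ι] (u v : OrthonormalBasis ι ℂ E)
    {S T : E →ₗ[ℂ] E} (hS : S.IsSymmetric) (hT : T.IsSymmetric) {a b : ι → ℝ}
    (ha : Monotone a) (hb : Monotone b)
    (hSu : ∀ i, S (u i) = (a i : ℂ) • u i) (hTv : ∀ i, T (v i) = (b i : ℂ) • v i) {c : ℝ}
    (h : ∀ x, (inner ℂ x (S x)).re ≤ (inner ℂ x (T x)).re + c * ‖x‖ ^ 2) (i : ι) :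
    a i ≤ b i + c := by
  have : FiniteDimensional ℂ E := u.toBasis.finiteDimensional_of_finite
  -- One functional for each index other than `i`, so the kernel is nonzero. A vector in it lies in
  -- the span of the `u j` with `j ≥ i` and in that of the `v j` with `j ≤ i`, which bounds the two
  -- quadratic forms by `a i` from below and by `b i` from above.
  let L : E →ₗ[ℂ] ({j // j ≠ i} → ℂ) :=
    LinearMap.pi fun j => if (j : ι) < i then innerₛₗ ℂ (u j) else innerₛₗ ℂ (v j)
  have hL : LinearMap.ker L ≠ ⊥ := by
    apply LinearMap.ker_ne_bot_of_finrank_lt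
    rw [Module.finrank_fintype_fun_eq_card, Module.finrank_eq_card_basis u.toBasis]
    exact Fintype.card_subtype_lt (x := i) (by simp)
  obtain ⟨x, hx, hx0⟩ := Submodule.exists_mem_ne_zero_of_ne_bot hL
  have hLx : ∀ j (hj : j ≠ i), L x ⟨j, hj⟩ = 0 := fun j hj => by
    rw [LinearMap.mem_ker.mp hx]; rfl
  have hu : ∀ j < i, inner ℂ (u j) x = 0 := fun j hj => by
    simpa [L, hj] using hLx j hj.ne
  have hv : ∀ j, i < j → inner ℂ (v j) x = 0 := fun j hj => by
    simpa [L, hj.not_gt] using hLx j hj.ne'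
  have h1 : a i * ‖x‖ ^ 2 ≤ (inner ℂ x (S x)).re := by
    rw [u.re_inner_apply_self hS hSu, ← u.sum_sq_norm_inner_right, Finset.mul_sum]
    refine Finset.sum_le_sum fun j _ => ?_
    rcases lt_or_ge j i with hj | hj
    · simp [hu j hj]
    · exact mul_le_mul_of_nonneg_right (ha hj) (sq_nonneg _)
  have h2 : (inner ℂ x (T x)).re ≤ b i * ‖x‖ ^ 2 := by
    rw [v.re_inner_apply_self hT hTv, ← v.sum_sq_norm_inner_right, Finset.mul_sum]
    refine Finset.sum_le_sum fun j _ => ?_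
    rcases lt_or_ge i j with hj | hj
    · simp [hv j hj]
    · exact mul_le_mul_of_nonneg_right (hb hj) (sq_nonneg _)
  have hpos : 0 < ‖x‖ ^ 2 := by positivity
  have h3 := h x
  nlinarith

/-- A symmetric operator on a finite-dimensional space has an orthonormal eigenbasis, indexed by
any linear order of the right size, with increasing eigenvalues. -/
theorem LinearMap.IsSymmetric.exists_monotone_eigenbasis [LinearOrder ι]
    [FiniteDimensional ℂ E] (hι : Module.finrank ℂ E = Fintype.card ι)
    {S : E →ₗ[ℂ] E} (hS : S.IsSymmetric) :
    ∃ (a : ι → ℝ) (u : OrthonormalBasis ι ℂ E), Monotone a ∧ ∀ i, S (u i) = (a i : ℂ) • u i := by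
  let o : Fin (Fintype.card ι) ≃o ι := Fintype.orderIsoFinOfCardEq ι rfl
  -- `eigenvalues` is decreasing, hence the reversal.
  refine ⟨fun i => hS.eigenvalues hι (o.symm i).rev,
    (hS.eigenvectorBasis hι).reindex (Fin.revPerm.trans o.toEquiv), ?_, fun i => ?_⟩
  · intro i j hij
    exact hS.eigenvalues_antitone hι (Fin.rev_le_rev.mpr (o.symm.monotone hij))
  · rw [OrthonormalBasis.reindex_apply]
    exact hS.apply_eigenvectorBasis hι _

end Weyl

/-! ### Finite truncations of the perturbed diagonal operator -/

section Truncation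

variable {ι H : Type*} [NormedAddCommGroup H] [InnerProductSpace ℂ H]

/-- The isometric inclusion of `ℂ^s` into `H` along the basis vectors with index in `s`. -/
def HilbertBasis.finIncl (b : HilbertBasis ι ℂ H) (s : Finset ι) : EuclideanSpace ℂ s →ₗᵢ[ℂ] H :=
  LinearMap.isometryOfOrthonormal
    ((EuclideanSpace.basisFun s ℂ).toBasis.constr ℂ fun k : s => b k)
    (v := (EuclideanSpace.basisFun s ℂ).toBasis)
    (by
      rw [OrthonormalBasis.coe_toBasis]
      exact (EuclideanSpace.basisFun s ℂ).orthonormal)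
    (by
      have h : (((EuclideanSpace.basisFun s ℂ).toBasis.constr ℂ fun k : s => b k) ∘
          (EuclideanSpace.basisFun s ℂ).toBasis) = fun k : s => b k := by
        funext k
        exact Module.Basis.constr_basis _ _ _ _
      rw [h]
      exact b.orthonormal.comp _ Subtype.val_injective)

theorem HilbertBasis.finIncl_basisFun (b : HilbertBasis ι ℂ H) (s : Finset ι) (k : s) :
    b.finIncl s (EuclideanSpace.basisFun s ℂ k) = b k := by
  have h := Module.Basis.constr_basis (EuclideanSpace.basisFun s ℂ).toBasis ℂ (fun k : s => b k) k
  rw [OrthonormalBasis.coe_toBasis] at h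
  exact h

variable [CompleteSpace H]

/-- The orthogonal projection of `H` onto `ℂ^s`. -/
def HilbertBasis.finProj (b : HilbertBasis ι ℂ H) (s : Finset ι) : H →L[ℂ] EuclideanSpace ℂ s :=
  ContinuousLinearMap.adjoint (b.finIncl s).toContinuousLinearMap

theorem HilbertBasis.inner_finProj (b : HilbertBasis ι ℂ H) (s : Finset ι) (x : EuclideanSpace ℂ s)
    (y : H) : inner ℂ x (b.finProj s y) = inner ℂ (b.finIncl s x) y :=
  ContinuousLinearMap.adjoint_inner_right _ _ _

theorem HilbertBasis.finProj_finIncl (b : HilbertBasis ι ℂ H) (s : Finset ι)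
    (x : EuclideanSpace ℂ s) : b.finProj s (b.finIncl s x) = x := by
  refine ext_inner_left ℂ fun z => ?_
  rw [b.inner_finProj, LinearIsometry.inner_map_map]

theorem HilbertBasis.finIncl_finProj (b : HilbertBasis ι ℂ H) (s : Finset ι) (y : H) :
    b.finIncl s (b.finProj s y) = ∑ k ∈ s, inner ℂ (b k) y • b k := by
  conv_lhs => rw [← (EuclideanSpace.basisFun s ℂ).sum_repr' (b.finProj s y)]
  rw [map_sum, ← Finset.sum_coe_sort s]
  refine Finset.sum_congr rfl fun k _ => ?_
  rw [map_smul, b.finIncl_basisFun, b.inner_finProj, b.finIncl_basisFun]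

theorem HilbertBasis.norm_finProj_le (b : HilbertBasis ι ℂ H) (s : Finset ι) (y : H) :
    ‖b.finProj s y‖ ≤ ‖y‖ := by
  have h : ‖b.finProj s‖ ≤ 1 := by
    rw [finProj, LinearIsometryEquiv.norm_map]
    exact (b.finIncl s).norm_toContinuousLinearMap_le
  simpa using (b.finProj s).le_of_opNorm_le h y

theorem HilbertBasis.tendsto_finIncl_finProj (b : HilbertBasis ι ℂ H) (y : H) :
    Tendsto (fun s => b.finIncl s (b.finProj s y)) atTop (𝓝 y) := by
  simp only [b.finIncl_finProj]
  have h := b.hasSum_repr y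
  simp only [b.repr_apply_apply] at h
  exact h

theorem HilbertBasis.norm_finIncl_finProj_le (b : HilbertBasis ι ℂ H) (s : Finset ι) (y : H) :
    ‖b.finIncl s (b.finProj s y)‖ ≤ ‖y‖ := by
  rw [LinearIsometry.norm_map]
  exact b.norm_finProj_le s y

/-- The compression to `ℂ^s` of the sum of the diagonal operator with entries `d` and the
bounded operator `B`. -/
def HilbertBasis.truncation (b : HilbertBasis ι ℂ H) (d : ι → ℝ) (B : H →L[ℂ] H) (s : Finset ι) :
    EuclideanSpace ℂ s →ₗ[ℂ] EuclideanSpace ℂ s :=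
  (b.finProj s).toLinearMap ∘ₗ (b.finDiagonal (fun i => (d i : ℂ)) s + B).toLinearMap ∘ₗ
    (b.finIncl s).toLinearMap

variable (b : HilbertBasis ι ℂ H) (d : ι → ℝ) {B B' : H →L[ℂ] H}

theorem HilbertBasis.truncation_apply (B : H →L[ℂ] H) (s : Finset ι) (x : EuclideanSpace ℂ s) :
    b.truncation d B s x = b.finProj s
      (b.finDiagonal (fun i => (d i : ℂ)) s (b.finIncl s x) + B (b.finIncl s x)) := rfl

theorem HilbertBasis.truncation_isSymmetric (hB : IsSelfAdjoint B) (s : Finset ι) :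
    (b.truncation d B s).IsSymmetric := by
  classical
  intro x y
  have hA : IsSelfAdjoint (b.finDiagonal (fun i => (d i : ℂ)) s + B) := by
    refine IsSelfAdjoint.add ?_ hB
    refine (b.isDiagonal_finDiagonal _ s).isSelfAdjoint fun i => ?_
    split_ifs <;> simp
  have h := hA.isSymmetric (b.finIncl s x) (b.finIncl s y)
  rw [truncation_apply, truncation_apply, b.inner_finProj, ← inner_conj_symm, b.inner_finProj,
    inner_conj_symm]
  exact h

theorem HilbertBasis.truncation_zero_basisFun (s : Finset ι) (k : s) :
    b.truncation d 0 s (EuclideanSpace.basisFun s ℂ k) =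
      (d k : ℂ) • EuclideanSpace.basisFun s ℂ k := by
  classical
  rw [truncation_apply, b.finIncl_basisFun, (b.isDiagonal_finDiagonal _ s).apply_basis]
  simp only [k.2, if_true, _root_.zero_apply, add_zero]
  rw [map_smul, ← b.finIncl_basisFun, b.finProj_finIncl]

/-- The diagonal parts cancel and the inclusion is isometric. The constant does not depend on `s`,
so Weyl's inequality will be uniform in the truncation. -/
theorem HilbertBasis.re_inner_truncation_le (B B' : H →L[ℂ] H) (s : Finset ι)
    (x : EuclideanSpace ℂ s) :
    (inner ℂ x (b.truncation d B s x)).re ≤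
      (inner ℂ x (b.truncation d B' s x)).re + ‖B - B'‖ * ‖x‖ ^ 2 := by
  rw [truncation_apply, truncation_apply, b.inner_finProj, b.inner_finProj, inner_add_right,
    inner_add_right, Complex.add_re, Complex.add_re, add_assoc]
  refine add_le_add le_rfl ?_
  set z := b.finIncl s x
  have hz : ‖x‖ = ‖z‖ := ((b.finIncl s).norm_map x).symm
  have h1 : (inner ℂ z (B z)).re - (inner ℂ z (B' z)).re = (inner ℂ z ((B - B') z)).re := by
    rw [_root_.sub_apply, inner_sub_right, Complex.sub_re]
  have h2 : (inner ℂ z ((B - B') z)).re ≤ ‖z‖ * ‖(B - B') z‖ :=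
    (Complex.re_le_norm _).trans (norm_inner_le_norm _ _)
  have h3 := mul_le_mul_of_nonneg_left ((B - B').le_opNorm z) (norm_nonneg z)
  rw [hz]
  nlinarith

variable [LinearOrder ι]

/-- Indexing by `s` with its inherited order gives eigenvalues of different truncations, and for
different `B`, a common label `k`. -/
theorem HilbertBasis.exists_truncated_eigenbasis (hB : IsSelfAdjoint B) (s : Finset ι) :
    ∃ (a : s → ℝ) (u : OrthonormalBasis s ℂ (EuclideanSpace ℂ s)), Monotone a ∧
      ∀ i, b.truncation d B s (u i) = (a i : ℂ) • u i :=
  (b.truncation_isSymmetric d hB s).exists_monotone_eigenbasis (by simp)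

/-- The eigenvalues of the truncation to `ℂ^s`, in increasing order; extended by `d`. -/
def HilbertBasis.truncEigenvalue (hB : IsSelfAdjoint B) (s : Finset ι) (k : ι) : ℝ :=
  -- The default `d k` keeps the Weyl bounds valid for every `s`, also when `k ∉ s`.
  if h : k ∈ s then (b.exists_truncated_eigenbasis d hB s).choose ⟨k, h⟩ else d k

/-- The eigenvectors of the truncation to `ℂ^s`, as elements of `H`; extended by zero. -/
def HilbertBasis.truncEigenvector (hB : IsSelfAdjoint B) (s : Finset ι) (k : ι) : H :=
  if h : k ∈ s then b.finIncl s ((b.exists_truncated_eigenbasis d hB s).choose_spec.choose ⟨k, h⟩)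
  else 0

theorem HilbertBasis.truncEigenvalue_sub_le (hB : IsSelfAdjoint B) (hB' : IsSelfAdjoint B')
    (s : Finset ι) (k : ι) :
    b.truncEigenvalue d hB s k ≤ b.truncEigenvalue d hB' s k + ‖B - B'‖ := by
  unfold truncEigenvalue
  split_ifs with h
  · have h1 := (b.exists_truncated_eigenbasis d hB s).choose_spec.choose_spec
    have h2 := (b.exists_truncated_eigenbasis d hB' s).choose_spec.choose_spec
    exact OrthonormalBasis.eigenvalue_le_add _ _ (b.truncation_isSymmetric d hB s)
      (b.truncation_isSymmetric d hB' s) h1.1 h2.1 h1.2 h2.2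
      (b.re_inner_truncation_le d B B' s) ⟨k, h⟩
  · exact le_add_of_nonneg_right (norm_nonneg _)

theorem HilbertBasis.abs_truncEigenvalue_sub_le (hB : IsSelfAdjoint B) (hB' : IsSelfAdjoint B')
    (s : Finset ι) (k : ι) :
    |b.truncEigenvalue d hB s k - b.truncEigenvalue d hB' s k| ≤ ‖B - B'‖ := by
  have h1 := b.truncEigenvalue_sub_le d hB hB' s k
  have h2 := b.truncEigenvalue_sub_le d hB' hB s k
  rw [norm_sub_rev] at h2
  rw [abs_le]
  constructor <;> linarith

/-- Weyl's inequality against `B = 0`: since `d` is monotone, the standard basis is already a sorted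
eigenbasis there. -/
theorem HilbertBasis.abs_truncEigenvalue_sub_diag_le (hd : Monotone d) (hB : IsSelfAdjoint B)
    (s : Finset ι) (k : ι) : |b.truncEigenvalue d hB s k - d k| ≤ ‖B‖ := by
  unfold truncEigenvalue
  split_ifs with h
  · have h1 := (b.exists_truncated_eigenbasis d hB s).choose_spec.choose_spec
    have hd' : Monotone fun i : s => d i := fun i j hij => hd hij
    have h0 := b.truncation_isSymmetric d (B := 0) (IsSelfAdjoint.zero _) s
    have h2 := OrthonormalBasis.eigenvalue_le_add _ _ (b.truncation_isSymmetric d hB s)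
      h0 h1.1 hd' h1.2 (b.truncation_zero_basisFun d s) (b.re_inner_truncation_le d B 0 s) ⟨k, h⟩
    have h3 := OrthonormalBasis.eigenvalue_le_add _ _ h0 (b.truncation_isSymmetric d hB s)
      hd' h1.1 (b.truncation_zero_basisFun d s) h1.2 (b.re_inner_truncation_le d 0 B s) ⟨k, h⟩
    simp only [sub_zero, zero_sub, norm_neg] at h2 h3
    rw [abs_le]
    constructor <;> linarith
  · simp

theorem HilbertBasis.inner_truncEigenvector (hB : IsSelfAdjoint B) {s : Finset ι} {i j : ι}
    (hi : i ∈ s) (hj : j ∈ s) :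
    inner ℂ (b.truncEigenvector d hB s i) (b.truncEigenvector d hB s j) =
      if i = j then (1 : ℂ) else 0 := by
  unfold truncEigenvector
  rw [dif_pos hi, dif_pos hj, LinearIsometry.inner_map_map,
    orthonormal_iff_ite.mp (OrthonormalBasis.orthonormal _)]
  simp

theorem HilbertBasis.finDiagonal_finIncl_finProj (s : Finset ι) (x : H) (c : ι → ℂ) :
    b.finIncl s (b.finProj s (b.finDiagonal c s x)) = b.finDiagonal c s x := by
  refine b.ext_inner fun i => ?_
  rw [b.finIncl_finProj, inner_sum]
  simp only [inner_smul_right, b.inner_self_eq_ite, b.isDiagonal_finDiagonal c s x]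
  simpa using fun h h' => absurd h' h

theorem HilbertBasis.finDiagonal_of_finIncl_finProj (s : Finset ι) (x : H) (c : ι → ℂ) :
    b.finDiagonal c s (b.finIncl s (b.finProj s x)) = b.finDiagonal c s x := by
  refine b.ext_inner fun i => ?_
  rw [b.isDiagonal_finDiagonal c s, b.isDiagonal_finDiagonal c s, b.finIncl_finProj, inner_sum]
  simp only [inner_smul_right, b.inner_self_eq_ite]
  split_ifs with h <;> simp [h]

variable {K : H →L[ℂ] H}

variable {b d} in
theorem HilbertBasis.IsDiagonal.inv_finDiagonal (hd0 : ∀ k, d k ≠ 0)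
    (hK : b.IsDiagonal (fun k => (d k : ℂ)⁻¹) K) (s : Finset ι) (x : H) :
    K (b.finDiagonal (fun i => (d i : ℂ)) s x) = b.finIncl s (b.finProj s x) := by
  refine b.ext_inner fun i => ?_
  rw [hK, b.isDiagonal_finDiagonal _ s, b.finIncl_finProj, inner_sum]
  simp only [inner_smul_right, b.inner_self_eq_ite]
  have hi : (d i : ℂ) ≠ 0 := by exact_mod_cast hd0 i
  split_ifs with h <;> simp [h, hi]

variable {b d} in
theorem HilbertBasis.IsDiagonal.finDiagonal_inv (hd0 : ∀ k, d k ≠ 0)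
    (hK : b.IsDiagonal (fun k => (d k : ℂ)⁻¹) K) (s : Finset ι) (x : H) :
    b.finDiagonal (fun i => (d i : ℂ)) s (K x) = b.finIncl s (b.finProj s x) := by
  refine b.ext_inner fun i => ?_
  rw [b.isDiagonal_finDiagonal _ s, hK, b.finIncl_finProj, inner_sum]
  simp only [inner_smul_right, b.inner_self_eq_ite]
  have hi : (d i : ℂ) ≠ 0 := by exact_mod_cast hd0 i
  split_ifs with h <;> simp [h, hi]

/-- The eigenvalue equation of the truncation, in resolvent form. -/
theorem HilbertBasis.truncEigenvector_eq (hd0 : ∀ k, d k ≠ 0)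
    (hK : b.IsDiagonal (fun k => (d k : ℂ)⁻¹) K) (hB : IsSelfAdjoint B) {s : Finset ι} {k : ι}
    (hk : k ∈ s) :
    b.truncEigenvector d hB s k =
      K ((b.truncEigenvalue d hB s k : ℂ) • b.truncEigenvector d hB s k -
        b.finIncl s (b.finProj s (B (b.truncEigenvector d hB s k)))) := by
  have h1 := (b.exists_truncated_eigenbasis d hB s).choose_spec.choose_spec.2 ⟨k, hk⟩
  unfold truncEigenvector truncEigenvalue
  rw [dif_pos hk, dif_pos hk]
  set u := (b.exists_truncated_eigenbasis d hB s).choose_spec.choose ⟨k, hk⟩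
  rw [truncation_apply] at h1
  have h2 := congrArg (b.finIncl s) h1
  rw [map_add, map_add, b.finDiagonal_finIncl_finProj, map_smul, ← eq_sub_iff_add_eq] at h2
  -- `K` undoes the truncated diagonal part on vectors supported in `s`.
  rw [← h2, hK.inv_finDiagonal hd0, b.finProj_finIncl]

/-- Eigenvectors of the truncation with large eigenvalues contribute little to vectors in the
domain of the diagonal operator. -/
theorem HilbertBasis.norm_sq_finProj_le (hd0 : ∀ k, d k ≠ 0)
    (hK : b.IsDiagonal (fun k => (d k : ℂ)⁻¹) K) (hB : IsSelfAdjoint B) (s F : Finset ι) (y : H)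
    {r : ℝ} (hr : 0 < r) (hF : ∀ k ∉ F, r ≤ |b.truncEigenvalue d hB s k|) :
    ‖b.finProj s (K y)‖ ^ 2 ≤ ∑ k ∈ F, ‖inner ℂ (b.truncEigenvector d hB s k) (K y)‖ ^ 2 +
      ((‖y‖ + ‖B‖ * ‖K y‖) / r) ^ 2 := by
  obtain ⟨u, hu⟩ : ∃ u, u = (b.exists_truncated_eigenbasis d hB s).choose_spec.choose := ⟨_, rfl⟩
  have hv : ∀ k (hk : k ∈ s), b.truncEigenvector d hB s k = b.finIncl s (u ⟨k, hk⟩) :=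
    fun k hk => by rw [truncEigenvector, dif_pos hk, hu]
  have hTu : ∀ k : s, b.truncation d B s (u k) = (b.truncEigenvalue d hB s k : ℂ) • u k := by
    intro k
    rw [truncEigenvalue, dif_pos k.2, hu]
    exact (b.exists_truncated_eigenbasis d hB s).choose_spec.choose_spec.2 k
  set w := b.finProj s (K y) with hw
  -- Because the vector is `K y`, the unbounded diagonal part returns only a projection of `y`; the
  -- bound is free of `s`.
  have hTw : ‖b.truncation d B s w‖ ≤ ‖y‖ + ‖B‖ * ‖K y‖ := by
    rw [truncation_apply]
    refine (b.norm_finProj_le _ _).trans ((norm_add_le _ _).trans (add_le_add ?_ ?_))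
    · rw [hw, b.finDiagonal_of_finIncl_finProj, hK.finDiagonal_inv hd0]
      exact b.norm_finIncl_finProj_le s y
    · refine (B.le_opNorm _).trans (mul_le_mul_of_nonneg_left ?_ (norm_nonneg _))
      exact b.norm_finIncl_finProj_le s (K y)
  have hin : ∀ k : s, ‖inner ℂ (u k) (b.truncation d B s w)‖ =
      |b.truncEigenvalue d hB s k| * ‖inner ℂ (u k) w‖ := fun k => by
    rw [← b.truncation_isSymmetric d hB s, hTu, inner_smul_left, norm_mul]
    simp
  have hsum : ∑ k : s, |b.truncEigenvalue d hB s k| ^ 2 * ‖inner ℂ (u k) w‖ ^ 2 ≤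
      (‖y‖ + ‖B‖ * ‖K y‖) ^ 2 := by
    have := u.sum_sq_norm_inner_right (b.truncation d B s w)
    simp only [hin, mul_pow] at this
    rw [this]
    gcongr
  -- Chebyshev's argument: off `F` the factor `|λ_k|² / r²` is at least one.
  have hterm : ∀ k : s, ‖inner ℂ (u k) w‖ ^ 2 ≤
      (if (k : ι) ∈ F then ‖inner ℂ (b.truncEigenvector d hB s k) (K y)‖ ^ 2 else 0) +
        (|b.truncEigenvalue d hB s k| ^ 2 * ‖inner ℂ (u k) w‖ ^ 2) / r ^ 2 := fun k => by
    split_ifs with h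
    · rw [hw, b.inner_finProj, hv k k.2]
      exact le_add_of_nonneg_right (by positivity)
    · rw [zero_add, le_div_iff₀ (by positivity), mul_comm]
      gcongr
      exact hF k h
  rw [← u.sum_sq_norm_inner_right w]
  refine (Finset.sum_le_sum fun k _ => hterm k).trans ?_
  rw [Finset.sum_add_distrib, ← Finset.sum_div, div_pow]
  refine add_le_add ?_ (by gcongr)
  rw [Finset.sum_coe_sort s fun k =>
    if k ∈ F then ‖inner ℂ (b.truncEigenvector d hB s k) (K y)‖ ^ 2 else 0, ← Finset.sum_filter]
  exact Finset.sum_le_sum_of_subset_of_nonneg (fun k hk => (Finset.mem_filter.mp hk).2)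
    fun _ _ _ => by positivity

end Truncation

/-! ### Passage to the limit along an ultrafilter -/

section Limit

variable {ι H : Type*} [NormedAddCommGroup H] [InnerProductSpace ℂ H] [CompleteSpace H]
  (b : HilbertBasis ι ℂ H) (d : ι → ℝ) {B B' : H →L[ℂ] H} {K : H →L[ℂ] H}

/-- An ultrafilter of finite index sets that eventually contain every given finite set. -/
def finsetUltrafilter (ι : Type*) : Ultrafilter (Finset ι) :=
  Ultrafilter.of atTop

theorem finsetUltrafilter_le (ι : Type*) : (finsetUltrafilter ι : Filter (Finset ι)) ≤ atTop :=
  Ultrafilter.of_le _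

theorem eventually_mem_finsetUltrafilter (k : ι) :
    ∀ᶠ s in (finsetUltrafilter ι : Filter (Finset ι)), k ∈ s := by
  have h : ∀ᶠ s : Finset ι in atTop, k ∈ s := by
    filter_upwards [eventually_ge_atTop {k}] with s hs
    exact hs (Finset.mem_singleton_self k)
  exact finsetUltrafilter_le ι h

/-- The projections are contractions converging strongly to the identity, so they may be applied to
a convergent family. -/
theorem HilbertBasis.tendsto_finIncl_finProj_apply {l : Filter (Finset ι)} (hl : l ≤ atTop)
    {f : Finset ι → H} {x : H} (hf : Tendsto f l (𝓝 x)) :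
    Tendsto (fun s => b.finIncl s (b.finProj s (f s))) l (𝓝 x) := by
  have h1 : Tendsto (fun s => b.finIncl s (b.finProj s (f s - x))) l (𝓝 0) :=
    squeeze_zero_norm (fun s => b.norm_finIncl_finProj_le s _)
      (tendsto_iff_norm_sub_tendsto_zero.mp hf)
  have h2 := h1.add ((b.tendsto_finIncl_finProj x).mono_left hl)
  simpa only [map_sub, sub_add_cancel, zero_add] using h2

variable [LinearOrder ι]

theorem HilbertBasis.exists_tendsto_truncEigenvalue (hd : Monotone d) (hB : IsSelfAdjoint B)
    (k : ι) :
    ∃ l : ℝ, Tendsto (fun s => b.truncEigenvalue d hB s k) (finsetUltrafilter ι) (𝓝 l) := by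
  obtain ⟨l, -, hl⟩ := (isCompact_closedBall (d k) ‖B‖).ultrafilter_le_nhds'
    ((finsetUltrafilter ι).map fun s => b.truncEigenvalue d hB s k)
    (Filter.mem_map.mpr (Eventually.of_forall fun s => by
      change dist _ _ ≤ _
      rw [Real.dist_eq]
      exact b.abs_truncEigenvalue_sub_diag_le d hd hB s k))
  exact ⟨l, hl⟩

/-- The limits of the eigenvalues of the truncations. -/
def HilbertBasis.limEigenvalue (hd : Monotone d) (hB : IsSelfAdjoint B) (k : ι) : ℝ :=
  (b.exists_tendsto_truncEigenvalue d hd hB k).choose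

theorem HilbertBasis.tendsto_truncEigenvalue (hd : Monotone d) (hB : IsSelfAdjoint B) (k : ι) :
    Tendsto (fun s => b.truncEigenvalue d hB s k) (finsetUltrafilter ι)
      (𝓝 (b.limEigenvalue d hd hB k)) :=
  (b.exists_tendsto_truncEigenvalue d hd hB k).choose_spec

/-- Both limits are taken along the same ultrafilter, so the uniform bound passes through. This is
the source of continuity in `t`. -/
theorem HilbertBasis.abs_limEigenvalue_sub_le (hd : Monotone d) (hB : IsSelfAdjoint B)
    (hB' : IsSelfAdjoint B') (k : ι) :
    |b.limEigenvalue d hd hB k - b.limEigenvalue d hd hB' k| ≤ ‖B - B'‖ :=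
  le_of_tendsto ((b.tendsto_truncEigenvalue d hd hB k).sub
    (b.tendsto_truncEigenvalue d hd hB' k)).abs
    (Eventually.of_forall fun s => b.abs_truncEigenvalue_sub_le d hB hB' s k)

theorem HilbertBasis.abs_limEigenvalue_sub_diag_le (hd : Monotone d) (hB : IsSelfAdjoint B)
    (k : ι) : |b.limEigenvalue d hd hB k - d k| ≤ ‖B‖ :=
  le_of_tendsto ((b.tendsto_truncEigenvalue d hd hB k).sub_const (d k)).abs
    (Eventually.of_forall fun s => b.abs_truncEigenvalue_sub_diag_le d hd hB s k)

theorem HilbertBasis.norm_truncEigenvector_le (hB : IsSelfAdjoint B) (s : Finset ι) (k : ι) :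
    ‖b.truncEigenvector d hB s k‖ ≤ 1 := by
  unfold truncEigenvector
  split_ifs with h
  · rw [LinearIsometry.norm_map, OrthonormalBasis.norm_eq_one]
  · simp

/-- In resolvent form the eigenvector is `K` of a vector of norm at most `|d k| + 2‖B‖`, so it stays
in a fixed compact set and the ultrafilter converges in norm. Weak limits could lose orthonormality.
-/
theorem HilbertBasis.exists_tendsto_truncEigenvector (hd : Monotone d) (hd0 : ∀ k, d k ≠ 0)
    (hK : b.IsDiagonal (fun k => (d k : ℂ)⁻¹) K) (hKc : IsCompactOperator K)
    (hB : IsSelfAdjoint B) (k : ι) :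
    ∃ v : H, Tendsto (fun s => b.truncEigenvector d hB s k) (finsetUltrafilter ι) (𝓝 v) := by
  obtain ⟨C, hC, hKC⟩ := IsCompactOperator.image_closedBall_subset_compact
    (f := K.toLinearMap) hKc (|d k| + ‖B‖ + ‖B‖)
  obtain ⟨v, -, hv⟩ := hC.ultrafilter_le_nhds'
    ((finsetUltrafilter ι).map fun s => b.truncEigenvector d hB s k)
    (Filter.mem_map.mpr ((eventually_mem_finsetUltrafilter k).mono fun s hs => by
      change b.truncEigenvector d hB s k ∈ C
      rw [b.truncEigenvector_eq d hd0 hK hB hs]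
      refine hKC (mem_image_of_mem _ ?_)
      have h1 := b.norm_truncEigenvector_le d hB s k
      have h2 : |b.truncEigenvalue d hB s k| ≤ |d k| + ‖B‖ := by
        have h3 := b.abs_truncEigenvalue_sub_diag_le d hd hB s k
        have h4 := abs_sub_abs_le_abs_sub (b.truncEigenvalue d hB s k) (d k)
        linarith
      rw [mem_closedBall_zero_iff]
      refine (norm_sub_le _ _).trans (add_le_add ?_ ?_)
      · rw [norm_smul, Complex.norm_real, Real.norm_eq_abs]
        exact (mul_le_of_le_one_right (abs_nonneg _) h1).trans h2
      · exact (b.norm_finIncl_finProj_le s _).trans ((B.le_opNorm _).trans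
          (mul_le_of_le_one_right (norm_nonneg _) h1))))
  exact ⟨v, hv⟩

/-- **Spectral theorem** for a bounded self-adjoint perturbation of a diagonal operator with
discrete spectrum, whose inverse is the compact operator `K`. -/
theorem HilbertBasis.exists_eigenbasis (hd : Monotone d) (hd0 : ∀ k, d k ≠ 0)
    (hfin : ∀ r : ℝ, {k | |d k| ≤ r}.Finite)
    (hK : b.IsDiagonal (fun k => (d k : ℂ)⁻¹) K) (hKc : IsCompactOperator K)
    (hB : IsSelfAdjoint B) :
    ∃ v : HilbertBasis ι ℂ H, ∀ k,
      v k = K ((b.limEigenvalue d hd hB k : ℂ) • v k - B (v k)) := by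
  choose v hv using b.exists_tendsto_truncEigenvector d hd hd0 hK hKc hB
  have horth : Orthonormal ℂ v := by
    rw [orthonormal_iff_ite]
    intro i j
    refine tendsto_nhds_unique ((hv i).inner (hv j)) (tendsto_const_nhds.congr' ?_)
    filter_upwards [eventually_mem_finsetUltrafilter i, eventually_mem_finsetUltrafilter j]
      with s hi hj
    rw [b.inner_truncEigenvector d hB hi hj]
  have heq : ∀ k, v k = K ((b.limEigenvalue d hd hB k : ℂ) • v k - B (v k)) := by
    intro k
    have hl : Tendsto (fun s => (b.truncEigenvalue d hB s k : ℂ)) (finsetUltrafilter ι)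
        (𝓝 (b.limEigenvalue d hd hB k : ℂ)) :=
      (Complex.continuous_ofReal.tendsto _).comp (b.tendsto_truncEigenvalue d hd hB k)
    have h1 := b.tendsto_finIncl_finProj_apply (finsetUltrafilter_le ι)
      ((B.continuous.tendsto _).comp (hv k))
    have h2 := (K.continuous.tendsto _).comp ((hl.smul (hv k)).sub h1)
    refine tendsto_nhds_unique (hv k) (h2.congr' ?_)
    filter_upwards [eventually_mem_finsetUltrafilter k] with s hk
    exact (b.truncEigenvector_eq d hd0 hK hB hk).symm
  -- Take `F` as the labels with `|d k| ≤ r + ‖B‖`. Off it every truncated eigenvalue has modulus at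
  -- least `r`, whatever `s` is, so the sum over `F` stays fixed in the limit.
  have hbound : ∀ (y : H) (r : ℝ), 0 < r → ∃ F : Finset ι,
      ‖K y‖ ^ 2 ≤ ∑ k ∈ F, ‖inner ℂ (v k) (K y)‖ ^ 2 + ((‖y‖ + ‖B‖ * ‖K y‖) / r) ^ 2 := by
    intro y r hr
    refine ⟨(hfin (r + ‖B‖)).toFinset, ?_⟩
    have h1 := ((b.tendsto_finIncl_finProj (K y)).mono_left (finsetUltrafilter_le ι)).norm.pow 2
    have h2 : Tendsto (fun s => ∑ k ∈ (hfin (r + ‖B‖)).toFinset,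
        ‖inner ℂ (b.truncEigenvector d hB s k) (K y)‖ ^ 2 + ((‖y‖ + ‖B‖ * ‖K y‖) / r) ^ 2)
        (finsetUltrafilter ι) (𝓝 (∑ k ∈ (hfin (r + ‖B‖)).toFinset,
        ‖inner ℂ (v k) (K y)‖ ^ 2 + ((‖y‖ + ‖B‖ * ‖K y‖) / r) ^ 2)) :=
      (tendsto_finsetSum _ fun k _ => ((hv k).inner tendsto_const_nhds).norm.pow 2).add_const _
    refine le_of_tendsto_of_tendsto' h1 h2 fun s => ?_
    rw [LinearIsometry.norm_map]
    refine b.norm_sq_finProj_le d hd0 hK hB s _ y hr fun k hk => ?_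
    simp only [Set.Finite.mem_toFinset, mem_ofPred_eq, not_le] at hk
    have h3 := b.abs_truncEigenvalue_sub_diag_le d hd hB s k
    have h4 := abs_sub_abs_le_abs_sub (d k) (b.truncEigenvalue d hB s k)
    rw [abs_sub_comm] at h4
    linarith
  have hdense : ∀ y, K y ∈ (Submodule.span ℂ (range v)).topologicalClosure := by
    intro y
    change K y ∈ closure (Submodule.span ℂ (range v) : Set H)
    rw [Metric.mem_closure_iff]
    intro r hr
    set M := ‖y‖ + ‖B‖ * ‖K y‖ with hM
    have hM0 : 0 ≤ M := by positivity
    -- With this threshold the remainder is `M r / (M + 1)`, which is less than `r`.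
    obtain ⟨F, hF⟩ := hbound y ((M + 1) / r) (by positivity)
    refine ⟨∑ k ∈ F, inner ℂ (v k) (K y) • v k, Submodule.sum_mem _ fun k _ =>
      Submodule.smul_mem _ _ (Submodule.subset_span ⟨k, rfl⟩), ?_⟩
    have hpyth : ‖K y - ∑ k ∈ F, inner ℂ (v k) (K y) • v k‖ ^ 2 =
        ‖K y‖ ^ 2 - ∑ k ∈ F, ‖inner ℂ (v k) (K y)‖ ^ 2 := by
      rw [@norm_sub_sq ℂ, inner_sum]
      have h1 : ‖∑ k ∈ F, inner ℂ (v k) (K y) • v k‖ ^ 2 =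
          ∑ k ∈ F, ‖inner ℂ (v k) (K y)‖ ^ 2 := by
        rw [@norm_sq_eq_re_inner ℂ, horth.inner_sum, map_sum]
        refine Finset.sum_congr rfl fun k _ => ?_
        rw [← Complex.normSq_eq_conj_mul_self, Complex.normSq_eq_norm_sq]
        exact Complex.ofReal_re _
      have h2 : ∀ k, inner ℂ (K y) (inner ℂ (v k) (K y) • v k) =
          ((‖inner ℂ (v k) (K y)‖ ^ 2 : ℝ) : ℂ) := fun k => by
        rw [inner_smul_right, ← inner_conj_symm (K y) (v k), Complex.mul_conj,
          Complex.normSq_eq_norm_sq]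
      simp only [h1, h2, ← Complex.ofReal_sum]
      rw [show ∀ t : ℝ, RCLike.re (t : ℂ) = t from Complex.ofReal_re]
      ring
    rw [dist_eq_norm]
    refine lt_of_pow_lt_pow_left₀ 2 hr.le ?_
    have h5 : (M / ((M + 1) / r)) ^ 2 < r ^ 2 := by
      refine pow_lt_pow_left₀ ?_ (by positivity) two_ne_zero
      rw [div_div_eq_mul_div, div_lt_iff₀ (by positivity)]
      nlinarith
    linarith
  -- Every `b k` lies in the range of `K`, so approximating that range suffices.
  have hspan : ⊤ ≤ (Submodule.span ℂ (range v)).topologicalClosure := by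
    rw [← b.dense_span]
    refine Submodule.topologicalClosure_minimal _ (Submodule.span_le.mpr ?_)
      (Submodule.isClosed_topologicalClosure _)
    rintro _ ⟨k, rfl⟩
    have h1 : K ((d k : ℂ) • b k) = b k := by
      rw [map_smul, hK.apply_basis, smul_smul, mul_inv_cancel₀ (by exact_mod_cast hd0 k), one_smul]
    rw [← h1]
    exact hdense _
  refine ⟨HilbertBasis.mk horth hspan, fun k => ?_⟩
  rw [HilbertBasis.coe_mk]
  exact heq k

end Limit

/-! ### Unbounded operators of the form `K⁻¹ + B` -/

section PerturbedInverse

variable {ι H : Type*} [NormedAddCommGroup H] [InnerProductSpace ℂ H]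

/-- `T` is the sum of the inverse of `K` and the bounded operator `B`, with domain the range
of `K`. -/
structure IsPerturbedInverse (K B : H →L[ℂ] H) (T : H →ₗ.[ℂ] H) : Prop where
  mem_domain : ∀ y, K y ∈ T.domain
  exists_eq : ∀ x ∈ T.domain, ∃ y, x = K y
  apply : ∀ y (h : K y ∈ T.domain), T ⟨K y, h⟩ = y + B (K y)

namespace IsPerturbedInverse

variable {K B : H →L[ℂ] H} {T : H →ₗ.[ℂ] H}

/-- Symmetry is a direct computation. For the reverse inclusion, testing `w = T* y` against all `K
z` gives `y = K (w - B y)`, so `y` is in the domain. -/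
theorem isSelfAdjoint [CompleteSpace H] (hT : IsPerturbedInverse K B T) (hK : IsSelfAdjoint K)
    (hKd : DenseRange K) (hB : IsSelfAdjoint B) : IsSelfAdjoint T := by
  have hKs : ∀ x y, inner ℂ (K x) y = inner ℂ x (K y) := hK.isSymmetric
  have hBs : ∀ x y, inner ℂ (B x) y = inner ℂ x (B y) := hB.isSymmetric
  have hd : Dense (T.domain : Set H) := hKd.mono (by
    rintro _ ⟨y, rfl⟩
    exact hT.mem_domain y)
  have hsymm : T.IsFormalAdjoint T := by
    rintro ⟨x, hx⟩ ⟨y, hy⟩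
    obtain ⟨p, rfl⟩ := hT.exists_eq x hx
    obtain ⟨q, rfl⟩ := hT.exists_eq y hy
    rw [hT.apply, hT.apply, inner_add_left, inner_add_right, hKs, hBs]
  rw [LinearPMap.isSelfAdjoint_def]
  refine (LinearPMap.eq_of_le_of_domain_eq (hsymm.le_adjoint hd)
    (le_antisymm (hsymm.le_adjoint hd).1 fun y hy => ?_)).symm
  have hadj := LinearPMap.adjoint_isFormalAdjoint hd ⟨y, hy⟩
  set w := T.adjoint ⟨y, hy⟩
  have h : y = K (w - B y) := by
    refine ext_inner_right ℂ fun z => ?_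
    have h1 := hadj ⟨K z, hT.mem_domain z⟩
    rw [hT.apply, inner_add_right] at h1
    change inner ℂ w (K z) = inner ℂ y z + inner ℂ y (B (K z)) at h1
    rw [hKs, inner_sub_left, hBs, h1]
    ring
  rw [h]
  exact hT.mem_domain _

/-- Solving the resolvent equation for the preimage under `K` gives `R = K (1 - B R + z R)`, a
compact operator after a bounded one. -/
theorem isCompactOperator_of_isResolventAt (hT : IsPerturbedInverse K B T)
    (hK : IsCompactOperator K) {z : ℂ} {R : H →L[ℂ] H} (hR : IsResolventAt T z R) :
    IsCompactOperator R := by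
  have h : R = K.comp (ContinuousLinearMap.id ℂ H - B.comp R + z • R) := by
    refine ContinuousLinearMap.ext fun y => ?_
    obtain ⟨hy, hy'⟩ := hR.1 y
    obtain ⟨u, hu⟩ := hT.exists_eq _ hy
    have h1 : T ⟨R y, hy⟩ = u + B (R y) := by
      have h2 : (⟨R y, hy⟩ : T.domain) = ⟨K u, hT.mem_domain u⟩ := Subtype.ext hu
      rw [h2, hT.apply, ← hu]
    have h3 : u = y - B (R y) + z • R y := by
      rw [h1] at hy'
      nth_rewrite 1 [← hy']
      abel
    rw [hu, h3]
    rfl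
  rw [h]
  exact hK.comp_clm _

variable {v : HilbertBasis ι ℂ H} {l : ι → ℝ}

/-- As `y + B (K y)` is the value of the operator at `K y`, this makes it multiplication by `l k` in
the coordinates of `v`. -/
theorem inner_eigenvector (hKs : ∀ x y, inner ℂ (K x) y = inner ℂ x (K y))
    (hBs : ∀ x y, inner ℂ (B x) y = inner ℂ x (B y))
    (hv : ∀ k, v k = K ((l k : ℂ) • v k - B (v k))) (k : ι) (y : H) :
    inner ℂ (v k) (y + B (K y)) = l k * inner ℂ (v k) (K y) := by
  have h : inner ℂ (v k) y = l k * inner ℂ (v k) (K y) - inner ℂ (v k) (B (K y)) := by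
    nth_rewrite 1 [hv k]
    rw [hKs, inner_sub_left, inner_smul_left, Complex.conj_ofReal, hBs]
  rw [inner_add_right, h]
  ring

theorem mem_domain_eigenvector (hT : IsPerturbedInverse K B T)
    (hv : ∀ k, v k = K ((l k : ℂ) • v k - B (v k))) (k : ι) : v k ∈ T.domain := by
  rw [hv k]
  exact hT.mem_domain _

theorem apply_eigenvector (hT : IsPerturbedInverse K B T)
    (hv : ∀ k, v k = K ((l k : ℂ) • v k - B (v k))) (k : ι) (h : v k ∈ T.domain) :
    T ⟨v k, h⟩ = (l k : ℂ) • v k := by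
  have h1 : (⟨v k, h⟩ : T.domain) = ⟨K ((l k : ℂ) • v k - B (v k)), hT.mem_domain _⟩ :=
    Subtype.ext (hv k)
  rw [h1, hT.apply, ← hv k, sub_add_cancel]

/-- The resolvent is the diagonal operator in `v` with entries `(l k - z)⁻¹`, bounded by `r⁻¹`. -/
theorem mem_unboundedResolventSet (hT : IsPerturbedInverse K B T)
    (hKs : ∀ x y, inner ℂ (K x) y = inner ℂ x (K y))
    (hBs : ∀ x y, inner ℂ (B x) y = inner ℂ x (B y))
    (hv : ∀ k, v k = K ((l k : ℂ) • v k - B (v k))) {z : ℂ} {r : ℝ} (hr : 0 < r)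
    (hz : ∀ k, r ≤ ‖(l k : ℂ) - z‖) : z ∈ unboundedResolventSet T := by
  have hne : ∀ k, (l k : ℂ) - z ≠ 0 := fun k h => by
    have := hz k
    rw [h, norm_zero] at this
    linarith
  obtain ⟨R, -, hR⟩ := v.exists_diagonal (fun k => ((l k : ℂ) - z)⁻¹) (C := r⁻¹) (by positivity)
    (fun k => by
      rw [norm_inv]
      exact inv_anti₀ hr (hz k))
  have hRv : ∀ k, R (v k) = ((l k : ℂ) - z)⁻¹ • v k :=
    HilbertBasis.IsDiagonal.apply_basis (c := fun k => ((l k : ℂ) - z)⁻¹) hR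
  -- Both sides are bounded, so the basis vectors suffice. The identity puts the whole range of `R`
  -- into the domain.
  have hRK : R = K.comp (ContinuousLinearMap.id ℂ H + z • R - B.comp R) := by
    refine v.clm_ext fun k => ?_
    change R (v k) = K (v k + z • R (v k) - B (R (v k)))
    rw [hRv]
    have h1 : v k + z • ((l k : ℂ) - z)⁻¹ • v k - B (((l k : ℂ) - z)⁻¹ • v k) =
        ((l k : ℂ) - z)⁻¹ • ((l k : ℂ) • v k - B (v k)) := by
      rw [map_smul, smul_sub, smul_smul, smul_smul]
      congr 1
      have h2 : ((l k : ℂ) - z)⁻¹ * l k = 1 + z * ((l k : ℂ) - z)⁻¹ := by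
        field_simp [hne k]
        ring
      rw [h2, add_smul, one_smul]
    rw [h1, map_smul, ← hv k]
  have hRK' : ∀ y, R y = K (y + z • R y - B (R y)) := fun y => DFunLike.congr_fun hRK y
  refine ⟨R, fun y => ?_, ?_⟩
  · have hy : R y ∈ T.domain := by
      rw [hRK' y]
      exact hT.mem_domain _
    refine ⟨hy, ?_⟩
    have h2 : (⟨R y, hy⟩ : T.domain) = ⟨K (y + z • R y - B (R y)), hT.mem_domain _⟩ :=
      Subtype.ext (hRK' y)
    rw [h2, hT.apply, ← hRK' y]
    abel
  · rintro ⟨x, hx⟩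
    obtain ⟨y, rfl⟩ := hT.exists_eq x hx
    rw [hT.apply]
    refine v.ext_inner fun k => ?_
    rw [hR, inner_sub_right, inner_eigenvector hKs hBs hv, inner_smul_right, ← sub_mul,
      inv_mul_cancel_left₀ (hne k)]

theorem ne_of_mem_unboundedResolventSet (hT : IsPerturbedInverse K B T)
    (hv : ∀ k, v k = K ((l k : ℂ) • v k - B (v k))) {z : ℂ} (hz : z ∈ unboundedResolventSet T)
    (k : ι) : (l k : ℂ) ≠ z := by
  rintro rfl
  obtain ⟨R, -, hR⟩ := hz
  have h1 := hR ⟨v k, hT.mem_domain_eigenvector hv k⟩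
  rw [hT.apply_eigenvector hv, sub_self, map_zero] at h1
  exact v.orthonormal.ne_zero k h1.symm

/-- A vector in the eigenspace has vanishing coefficients at all `k` with `l k ≠ μ`, so the `v k`
with `k ∈ s` form a basis of it. -/
theorem rank_unboundedEigenspace (hT : IsPerturbedInverse K B T)
    (hKs : ∀ x y, inner ℂ (K x) y = inner ℂ x (K y))
    (hBs : ∀ x y, inner ℂ (B x) y = inner ℂ x (B y))
    (hv : ∀ k, v k = K ((l k : ℂ) • v k - B (v k))) (μ : ℝ) (s : Finset ι)
    (hs : ∀ k, k ∈ s ↔ l k = μ) :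
    Module.rank ℂ (unboundedEigenspace T (μ : ℂ)) = (s.card : Cardinal) := by
  classical
  have hspan : unboundedEigenspace T (μ : ℂ) = Submodule.span ℂ (range fun k : s => v k) := by
    apply le_antisymm
    · rintro _ ⟨⟨x, hx⟩, hker, rfl⟩
      obtain ⟨y, rfl⟩ := hT.exists_eq x hx
      have h1 : y + B (K y) = (μ : ℂ) • K y := by
        rw [← hT.apply y hx]
        exact sub_eq_zero.mp hker
      have h2 : K y = ∑ k ∈ s, inner ℂ (v k) (K y) • v k := by
        refine v.ext_inner fun k => ?_
        simp only [inner_sum, inner_smul_right, v.inner_self_eq_ite]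
        have h3 := inner_eigenvector hKs hBs hv k y
        rw [h1, inner_smul_right] at h3
        by_cases hk : k ∈ s
        · simp [hk]
        · have h4 : (μ : ℂ) - l k ≠ 0 := by
            have h6 : μ ≠ l k := fun h => hk ((hs k).mpr h.symm)
            rw [sub_ne_zero]
            exact_mod_cast h6
          have h5 : ((μ : ℂ) - l k) * inner ℂ (v k) (K y) = 0 := by
            rw [sub_mul, h3, sub_self]
          simpa [hk] using (mul_eq_zero.mp h5).resolve_left h4
      change K y ∈ _
      rw [h2]
      exact Submodule.sum_mem _ fun k hk =>
        Submodule.smul_mem _ _ (Submodule.subset_span ⟨⟨k, hk⟩, rfl⟩)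
    · rw [Submodule.span_le]
      rintro _ ⟨⟨k, hk⟩, rfl⟩
      refine ⟨⟨v k, hT.mem_domain_eigenvector hv k⟩, ?_, rfl⟩
      change T ⟨v k, _⟩ - (μ : ℂ) • v k = 0
      rw [hT.apply_eigenvector hv, (hs k).mp hk, sub_self]
  have hli : LinearIndependent ℂ fun k : s => v k :=
    (v.orthonormal.comp _ Subtype.val_injective).linearIndependent
  have hfd : Module.Finite ℂ (Submodule.span ℂ (range fun k : s => v k)) :=
    FiniteDimensional.span_of_finite ℂ (finite_range _)
  rw [hspan, ← Module.finrank_eq_rank, finrank_span_eq_card hli]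
  simp

end IsPerturbedInverse

end PerturbedInverse

/-! ### Counting crossings with a global labelling -/

section SpectralFlow

variable {ι H : Type*} [NormedAddCommGroup H] [InnerProductSpace ℂ H]

/-- A global continuous labelling of the discrete real spectrum of a family of unbounded
operators. -/
structure IsEigenvalueLabelling (T : unitInterval → H →ₗ.[ℂ] H) (l : ι → unitInterval → ℝ) :
    Prop where
  continuous : ∀ k, Continuous (l k)
  proper : ∀ r : ℝ, ∃ F : Finset ι, ∀ k ∉ F, ∀ t, r < |l k t|
  mem_resolventSet : ∀ t (μ : ℝ), (μ : ℂ) ∈ unboundedResolventSet (T t) ↔ ∀ k, l k t ≠ μ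
  rank_eigenspace : ∀ t (μ : ℝ) (s : Finset ι), (∀ k, k ∈ s ↔ l k t = μ) →
    Module.rank ℂ (unboundedEigenspace (T t) (μ : ℂ)) = (s.card : Cardinal)

/-- The indicator of the nonnegative reals. -/
def nonnegIndicator (x : ℝ) : ℤ := if 0 ≤ x then 1 else 0

/-- The right side separates the endpoints, so the count no longer depends on how branches pair
initial with final values. -/
theorem card_upcrossing_sub_card_downcrossing {α : Type*} [Fintype α] (x y : α → ℝ) :
    ((Finset.univ.filter fun a => x a < 0 ∧ 0 ≤ y a).card : ℤ) -
      ((Finset.univ.filter fun a => 0 ≤ x a ∧ y a < 0).card : ℤ) =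
      ∑ a, nonnegIndicator (y a) - ∑ a, nonnegIndicator (x a) := by
  rw [Finset.card_filter, Finset.card_filter]
  push_cast
  rw [← Finset.sum_sub_distrib, ← Finset.sum_sub_distrib]
  refine Finset.sum_congr rfl fun a _ => ?_
  unfold nonnegIndicator
  grind

theorem Fin.sum_succ_sub_castSucc {n : ℕ} (f : Fin (n + 1) → ℤ) :
    ∑ i : Fin n, (f i.succ - f i.castSucc) = f (Fin.last n) - f 0 := by
  have h1 := Fin.sum_univ_succ f
  have h2 := Fin.sum_univ_castSucc f
  rw [Finset.sum_sub_distrib]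
  linarith

theorem ContinuousOn.lt_iff_lt_of_forall_ne {α : Type*} [TopologicalSpace α] {s : Set α}
    (hs : IsPreconnected s) {f : α → ℝ} (hf : ContinuousOn f s) {c : ℝ}
    (hc : ∀ x ∈ s, f x ≠ c) {x y : α} (hx : x ∈ s) (hy : y ∈ s) : f x < c ↔ f y < c := by
  have key : ∀ x ∈ s, ∀ y ∈ s, f x < c → f y < c := by
    intro x hx y hy h
    by_contra! hle
    obtain ⟨z, hz, hzc⟩ := hs.intermediate_value hx hy hf ⟨h.le, hle⟩
    exact hc z hz hzc
  exact ⟨key x hx y hy, key y hy x hx⟩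

namespace IsEigenvalueLabelling

variable {T : unitInterval → H →ₗ.[ℂ] H} {l : ι → unitInterval → ℝ}

/-- By properness only finitely many labels can reach the level, so a finite intersection of open
sets remains. -/
theorem isOpen_gap (hl : IsEigenvalueLabelling T l) (ε : ℝ) : IsOpen {t | ∀ k, |l k t| ≠ ε} := by
  obtain ⟨F, hF⟩ := hl.proper ε
  have h : {t | ∀ k, |l k t| ≠ ε} = ⋂ k ∈ F, {t | |l k t| ≠ ε} := by
    ext t
    simp only [mem_ofPred_eq, mem_iInter]
    refine ⟨fun h k _ => h k, fun h k => ?_⟩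
    by_cases hk : k ∈ F
    · exact h k hk
    · exact (hF k hk t).ne'
  rw [h]
  exact isOpen_biInter_finset fun k _ => isOpen_ne_fun (hl.continuous k).abs continuous_const

theorem exists_gap (hl : IsEigenvalueLabelling T l) (t : unitInterval) :
    ∃ ε > 0, ∀ k, |l k t| ≠ ε := by
  classical
  obtain ⟨F, hF⟩ := hl.proper 1
  obtain ⟨ε, hε, hεF⟩ := (Ioo_infinite (zero_lt_one' ℝ)).exists_notMem_finset
    (F.image fun k => |l k t|)
  refine ⟨ε, hε.1, fun k hk => ?_⟩
  by_cases hkF : k ∈ F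
  · exact hεF (Finset.mem_image.mpr ⟨k, hkF, hk⟩)
  · have := hF k hkF t
    linarith [hε.2]

theorem gap_iff (hl : IsEigenvalueLabelling T l) {ε : ℝ} (hε : 0 < ε) (t : unitInterval) :
    ((ε : ℂ) ∈ unboundedResolventSet (T t) ∧ (-(ε : ℂ)) ∈ unboundedResolventSet (T t)) ↔
      ∀ k, |l k t| ≠ ε := by
  have h := hl.mem_resolventSet t (-ε)
  rw [Complex.ofReal_neg] at h
  rw [hl.mem_resolventSet, h, ← forall_and]
  refine forall_congr' fun k => ?_
  rw [Ne, Ne, Ne, abs_eq hε.le, not_or]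

theorem nonempty_spectralGrid (hl : IsEigenvalueLabelling T l) : Nonempty (SpectralGrid T) := by
  -- The times at which a level `ε` is free form an open set, and these sets cover `[0,1]`. A
  -- uniform mesh `1 / (n + 1)` below the Lebesgue number puts each subinterval in one of them.
  obtain ⟨δ, hδ, hcov⟩ := lebesgue_number_lemma_of_metric (isCompact_univ (X := unitInterval))
    (c := fun ε : {ε : ℝ // 0 < ε} => {t | ∀ k, |l k t| ≠ ε}) (fun ε => hl.isOpen_gap ε)
    (fun t _ => by
      obtain ⟨ε, hε, h⟩ := hl.exists_gap t
      exact mem_iUnion.mpr ⟨⟨ε, hε⟩, h⟩)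
  obtain ⟨n, hn⟩ := exists_nat_one_div_lt hδ
  have hn0 : (0 : ℝ) < n + 1 := by positivity
  let t : Fin (n + 1 + 1) → unitInterval := fun i => ⟨(i : ℝ) / (n + 1), by positivity, by
    rw [div_le_one hn0]
    exact_mod_cast Nat.lt_succ_iff.mp i.2⟩
  choose ε hε using fun i : Fin (n + 1) => hcov (t i.castSucc) (mem_univ _)
  refine ⟨⟨n + 1, t, fun i j hij => ?_, ?_, ?_, fun i => ε i, fun i => (ε i).2,
    fun i τ hτ => (hl.gap_iff (ε i).2 τ).mpr (hε i ?_)⟩⟩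
  · change (i : ℝ) / (n + 1) < (j : ℝ) / (n + 1)
    gcongr
    exact hij
  · exact Subtype.ext (by simp [t])
  · refine Subtype.ext ?_
    simp only [t, Fin.val_last, Nat.cast_add, Nat.cast_one]
    exact div_self hn0.ne'
  · rw [Metric.mem_ball, Subtype.dist_eq, Real.dist_eq]
    have h1 : (t i.castSucc : ℝ) ≤ τ := hτ.1
    have h2 : (τ : ℝ) ≤ t i.succ := hτ.2
    have h3 : (t i.succ : ℝ) = t i.castSucc + 1 / (n + 1) := by
      simp only [t, Fin.val_succ, Fin.val_castSucc]
      push_cast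
      ring
    rw [abs_of_nonneg (by linarith)]
    linarith

theorem lt_iff_of_mem_grid (hl : IsEigenvalueLabelling T l) (G : SpectralGrid T) (i : Fin G.n)
    (k : ι) {τ : unitInterval} (hτ : τ ∈ Icc (G.t i.castSucc) (G.t i.succ)) :
    (l k τ < G.ε i ↔ l k (G.t i.castSucc) < G.ε i) ∧
      (l k τ < -G.ε i ↔ l k (G.t i.castSucc) < -G.ε i) ∧
      l k τ ≠ G.ε i ∧ l k τ ≠ -G.ε i := by
  have hgap : ∀ τ ∈ Icc (G.t i.castSucc) (G.t i.succ), l k τ ≠ G.ε i ∧ l k τ ≠ -G.ε i :=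
    fun τ hτ => by
      have h := (hl.gap_iff (G.ε_pos i) τ).mp (G.gap i τ hτ) k
      rwa [Ne, abs_eq (G.ε_pos i).le, not_or] at h
  have ha : G.t i.castSucc ∈ Icc (G.t i.castSucc) (G.t i.succ) :=
    ⟨le_rfl, G.strictMono.monotone (Fin.castSucc_lt_succ (i := i)).le⟩
  have hc := (hl.continuous k).continuousOn (s := Icc (G.t i.castSucc) (G.t i.succ))
  exact ⟨ContinuousOn.lt_iff_lt_of_forall_ne isPreconnected_Icc hc (fun x hx => (hgap x hx).1) hτ ha,
    ContinuousOn.lt_iff_lt_of_forall_ne isPreconnected_Icc hc (fun x hx => (hgap x hx).2) hτ ha,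
    hgap τ hτ⟩

theorem mem_window_iff (hl : IsEigenvalueLabelling T l) (G : SpectralGrid T) (i : Fin G.n)
    (k : ι) {τ : unitInterval} (hτ : τ ∈ Icc (G.t i.castSucc) (G.t i.succ)) :
    l k τ ∈ Ioo (-G.ε i) (G.ε i) ↔ l k (G.t i.castSucc) ∈ Ioo (-G.ε i) (G.ε i) := by
  obtain ⟨h1, h2, h3, h4⟩ := hl.lt_iff_of_mem_grid G i k hτ
  obtain ⟨-, -, h5, h6⟩ := hl.lt_iff_of_mem_grid G i k (τ := G.t i.castSucc)
    ⟨le_rfl, hτ.1.trans hτ.2⟩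
  rw [mem_Ioo, mem_Ioo, h1, lt_iff_not_ge, lt_iff_not_ge (a := -G.ε i), h4.le_iff_lt, h6.le_iff_lt,
    h2]

/-- To change sign, a label outside the window would first have to cross `ε` or `-ε`, which the gap
forbids. -/
theorem nonnegIndicator_eq_of_notMem_window (hl : IsEigenvalueLabelling T l) (G : SpectralGrid T)
    (i : Fin G.n) (k : ι) {τ : unitInterval} (hτ : τ ∈ Icc (G.t i.castSucc) (G.t i.succ))
    (hk : l k (G.t i.castSucc) ∉ Ioo (-G.ε i) (G.ε i)) :
    nonnegIndicator (l k τ) = nonnegIndicator (l k (G.t i.castSucc)) := by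
  have hk' := (not_congr (hl.mem_window_iff G i k hτ)).mpr hk
  obtain ⟨h1, h2, -, -⟩ := hl.lt_iff_of_mem_grid G i k hτ
  have hε := G.ε_pos i
  have h : 0 ≤ l k τ ↔ 0 ≤ l k (G.t i.castSucc) := by
    rw [mem_Ioo, not_and', not_lt] at hk hk'
    constructor
    · intro h
      by_contra! hlt
      have h3 := hk' (h1.mpr (by linarith))
      linarith
    · intro h
      by_contra! hlt
      have h3 := hk (h1.mp (by linarith))
      linarith
  unfold nonnegIndicator
  rw [if_congr h rfl rfl]

theorem exists_window_finset (hl : IsEigenvalueLabelling T l) (G : SpectralGrid T) (i : Fin G.n) :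
    ∃ s : Finset ι, ∀ k, k ∈ s ↔ l k (G.t i.castSucc) ∈ Ioo (-G.ε i) (G.ε i) := by
  classical
  obtain ⟨F, hF⟩ := hl.proper (G.ε i)
  refine ⟨F.filter fun k => l k (G.t i.castSucc) ∈ Ioo (-G.ε i) (G.ε i), fun k => ?_⟩
  rw [Finset.mem_filter, and_iff_right_iff_imp]
  intro h
  by_contra hk
  exact (hF k hk (G.t i.castSucc)).not_gt (abs_lt.mpr h)

theorem rank_eigenspace_eq_card_filter (hl : IsEigenvalueLabelling T l) (G : SpectralGrid T)
    (i : Fin G.n) {s : Finset ι}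
    (hs : ∀ k, k ∈ s ↔ l k (G.t i.castSucc) ∈ Ioo (-G.ε i) (G.ε i)) {τ : unitInterval}
    (hτ : τ ∈ Icc (G.t i.castSucc) (G.t i.succ)) {μ : ℝ} (hμ : μ ∈ Ioo (-G.ε i) (G.ε i)) :
    Module.rank ℂ (unboundedEigenspace (T τ) (μ : ℂ)) =
      ((s.filter fun k => l k τ = μ).card : Cardinal) := by
  refine hl.rank_eigenspace τ μ _ fun k => ?_
  rw [Finset.mem_filter, and_iff_right_iff_imp]
  rintro rfl
  exact (hs k).mpr ((hl.mem_window_iff G i k hτ).mp hμ)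

theorem nonempty_eigenvalueBranches (hl : IsEigenvalueLabelling T l) (G : SpectralGrid T) :
    Nonempty (EigenvalueBranches G) := by
  choose s hs using hl.exists_window_finset G
  refine ⟨⟨fun i => (s i).card, fun i j => l ((s i).equivFin.symm j),
    fun i j => (hl.continuous _).continuousOn,
    fun i j τ hτ => (hl.mem_window_iff G i _ hτ).mpr ((hs i _).mp ((s i).equivFin.symm j).2),
    fun i τ hτ μ hμ => ?_⟩⟩
  rw [hl.rank_eigenspace_eq_card_filter G i (hs i) hτ hμ]
  congr 1
  refine (Finset.card_bij (fun j _ => ((s i).equivFin.symm j : ι)) ?_ ?_ ?_).symm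
  · intro j hj
    exact Finset.mem_filter.mpr ⟨((s i).equivFin.symm j).2, (Finset.mem_filter.mp hj).2⟩
  · intro j _ j' _ h
    exact (s i).equivFin.symm.injective (Subtype.ext h)
  · intro k hk
    obtain ⟨hks, hkμ⟩ := Finset.mem_filter.mp hk
    exact ⟨(s i).equivFin ⟨k, hks⟩, by simpa using hkμ, by simp⟩

/-- Both families list the eigenvalues in the window with multiplicity, so they agree as multisets
at each time, even if no single branch follows a single label. -/
theorem sum_nonnegIndicator_branch (hl : IsEigenvalueLabelling T l) {G : SpectralGrid T}
    (β : EigenvalueBranches G) (i : Fin G.n) {s : Finset ι}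
    (hs : ∀ k, k ∈ s ↔ l k (G.t i.castSucc) ∈ Ioo (-G.ε i) (G.ε i)) {τ : unitInterval}
    (hτ : τ ∈ Icc (G.t i.castSucc) (G.t i.succ)) :
    ∑ j, nonnegIndicator (β.branch i j τ) = ∑ k ∈ s, nonnegIndicator (l k τ) := by
  classical
  have h : (Finset.univ.val.map fun j => β.branch i j τ) = s.val.map fun k => l k τ := by
    ext μ
    rw [Multiset.count_map, Multiset.count_map]
    by_cases hμ : μ ∈ Ioo (-G.ε i) (G.ε i)
    · have h1 := (β.multiplicity i τ hτ μ hμ).symm.trans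
        (hl.rank_eigenspace_eq_card_filter G i hs hτ hμ)
      rw [Nat.cast_inj] at h1
      simp only [eq_comm (a := μ)]
      exact h1
    · have h1 : ∀ j, μ ≠ β.branch i j τ := by
        rintro j rfl
        exact hμ (β.mem_window i j τ hτ)
      have h2 : ∀ k ∈ s.val, ¬μ = l k τ := by
        rintro k hk rfl
        exact hμ ((hl.mem_window_iff G i k hτ).mpr ((hs k).mp hk))
      rw [Multiset.filter_eq_nil.mpr h2, Multiset.filter_eq_nil.mpr fun j _ => h1 j]
      rfl
  have h2 := congrArg (fun m => (m.map nonnegIndicator).sum) h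
  simp only [Multiset.map_map] at h2
  exact h2

/-- The signed count of crossings equals the total signed count of sign changes of the labelled
eigenvalues. -/
theorem signedCount_eq_finsum (hl : IsEigenvalueLabelling T l) {G : SpectralGrid T}
    (β : EigenvalueBranches G) :
    β.signedCount = ∑ᶠ k, (nonnegIndicator (l k 1) - nonnegIndicator (l k 0)) := by
  classical
  choose s hs using hl.exists_window_finset G
  -- Labels in no window never change their indicator over any subinterval, so the sum over all
  -- labels reduces to `W`.
  let W : Finset ι := Finset.univ.biUnion s
  have hab : ∀ i : Fin G.n, G.t i.castSucc ≤ G.t i.succ :=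
    fun i => G.strictMono.monotone (Fin.castSucc_lt_succ (i := i)).le
  have hzero : ∀ i, ∀ k ∉ s i, nonnegIndicator (l k (G.t i.succ)) -
      nonnegIndicator (l k (G.t i.castSucc)) = 0 := fun i k hk => by
    rw [hl.nonnegIndicator_eq_of_notMem_window G i k ⟨hab i, le_rfl⟩ (fun h => hk ((hs i k).mpr h)),
      sub_self]
  have htel : ∀ k, ∑ i : Fin G.n, (nonnegIndicator (l k (G.t i.succ)) -
      nonnegIndicator (l k (G.t i.castSucc))) =
      nonnegIndicator (l k 1) - nonnegIndicator (l k 0) := fun k => by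
    rw [Fin.sum_succ_sub_castSucc fun i => nonnegIndicator (l k (G.t i)), G.t_last, G.t_zero]
  have hsupp : Function.support (fun k => nonnegIndicator (l k 1) - nonnegIndicator (l k 0)) ⊆
      W := by
    intro k hk
    by_contra hkW
    refine hk ?_
    change nonnegIndicator (l k 1) - nonnegIndicator (l k 0) = 0
    rw [← htel k]
    refine Finset.sum_eq_zero fun i _ => hzero i k fun h => hkW ?_
    exact Finset.mem_coe.mpr (Finset.mem_biUnion.mpr ⟨i, Finset.mem_univ i, h⟩)
  rw [finsum_eq_sum_of_support_subset _ hsupp]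
  simp only [← htel]
  rw [Finset.sum_comm]
  refine Finset.sum_congr rfl fun i _ => ?_
  rw [card_upcrossing_sub_card_downcrossing,
    hl.sum_nonnegIndicator_branch β i (hs i) ⟨hab i, le_rfl⟩,
    hl.sum_nonnegIndicator_branch β i (hs i) ⟨le_rfl, hab i⟩, ← Finset.sum_sub_distrib]
  exact Finset.sum_subset (Finset.subset_biUnion_of_mem s (Finset.mem_univ i))
    fun k _ hk => hzero i k hk

end IsEigenvalueLabelling

end SpectralFlow

/-! ### The half-integer operator on the Sobolev scale -/

namespace TwistedSobolev

variable {s : ℝ}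

/-- The orthonormal basis of multiples of the modes in `H^s_{1/2}`. -/
def hilbertBasis (s : ℝ) : HilbertBasis ℤ ℂ (TwistedSobolev s) :=
  HilbertBasis.ofRepr (toEll2Isometry s)

theorem inner_hilbertBasis (f : TwistedSobolev s) (k : ℤ) :
    inner ℂ (hilbertBasis s k) f = ((twistedWeight k ^ (s / 2) : ℝ) : ℂ) * coeff s f k := by
  rw [← (hilbertBasis s).repr_apply_apply]
  rfl

/-- The eigenvalue `k + 1/2` of the unperturbed operator. -/
def halfInteger (k : ℤ) : ℝ := (k : ℝ) + 1 / 2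

theorem halfInteger_monotone : Monotone halfInteger := fun i j h => by
  unfold halfInteger
  gcongr

/-- The twist keeps `0` out of the unperturbed spectrum, so the inverse exists with norm at most
`2`. -/
theorem one_half_le_abs_halfInteger (k : ℤ) : 1 / 2 ≤ |halfInteger k| := by
  unfold halfInteger
  rcases le_or_gt 0 k with h | h
  · have : (0 : ℝ) ≤ k := by exact_mod_cast h
    rw [abs_of_nonneg (by linarith)]
    linarith
  · have : (k : ℝ) ≤ -1 := by exact_mod_cast Int.le_sub_one_of_lt h
    rw [abs_of_nonpos (by linarith)]
    linarith

theorem halfInteger_ne_zero (k : ℤ) : halfInteger k ≠ 0 := by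
  have h := one_half_le_abs_halfInteger k
  rintro h0
  rw [h0] at h
  norm_num at h

theorem ofReal_halfInteger_ne_zero (k : ℤ) : (halfInteger k : ℂ) ≠ 0 := by
  exact_mod_cast halfInteger_ne_zero k

theorem finite_abs_halfInteger_le (r : ℝ) : {k | |halfInteger k| ≤ r}.Finite := by
  refine (finite_Icc (⌊-r - 1⌋) (⌈r⌉)).subset fun k hk => ?_
  obtain ⟨h1, h2⟩ := abs_le.mp (show |halfInteger k| ≤ r from hk)
  unfold halfInteger at h1 h2
  constructor
  · exact_mod_cast (Int.floor_le _).trans (show -r - 1 ≤ k by linarith)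
  · exact_mod_cast (show (k : ℝ) ≤ r by linarith).trans (Int.le_ceil r)

theorem exists_inverse (s : ℝ) : ∃ K : TwistedSobolev s →L[ℂ] TwistedSobolev s,
    (hilbertBasis s).IsDiagonal (fun k => (halfInteger k : ℂ)⁻¹) K := by
  obtain ⟨K, -, hK⟩ := (hilbertBasis s).exists_diagonal (fun k => (halfInteger k : ℂ)⁻¹) (C := 2)
    (by norm_num) (fun k => by
      rw [norm_inv, Complex.norm_real, Real.norm_eq_abs]
      have h := one_half_le_abs_halfInteger k
      exact (inv_anti₀ (by norm_num) h).trans (by norm_num))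
  exact ⟨K, hK⟩

variable {K : TwistedSobolev s →L[ℂ] TwistedSobolev s}

theorem isCompactOperator_inverse
    (hK : (hilbertBasis s).IsDiagonal (fun k => (halfInteger k : ℂ)⁻¹) K) :
    IsCompactOperator K := by
  refine hK.isCompactOperator fun r hr => (finite_abs_halfInteger_le r⁻¹).subset fun k hk => ?_
  change r < ‖(halfInteger k : ℂ)⁻¹‖ at hk
  rw [norm_inv, Complex.norm_real, Real.norm_eq_abs] at hk
  have h := one_half_le_abs_halfInteger k
  exact (le_inv_comm₀ hr (by linarith)).mp hk.le

theorem isSelfAdjoint_inverse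
    (hK : (hilbertBasis s).IsDiagonal (fun k => (halfInteger k : ℂ)⁻¹) K) : IsSelfAdjoint K :=
  hK.isSelfAdjoint fun k => by simp

theorem denseRange_inverse
    (hK : (hilbertBasis s).IsDiagonal (fun k => (halfInteger k : ℂ)⁻¹) K) : DenseRange K := by
  have h : (Submodule.span ℂ (range (hilbertBasis s)) : Set (TwistedSobolev s)) ⊆ range K := by
    change Submodule.span ℂ _ ≤ LinearMap.range K.toLinearMap
    rw [Submodule.span_le]
    rintro _ ⟨k, rfl⟩
    refine ⟨(halfInteger k : ℂ) • hilbertBasis s k, ?_⟩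
    change K _ = _
    rw [map_smul, hK.apply_basis, smul_smul, mul_inv_cancel₀ (ofReal_halfInteger_ne_zero k),
      one_smul]
  refine Dense.mono h ?_
  rw [dense_iff_closure_eq, ← Submodule.topologicalClosure_coe, (hilbertBasis s).dense_span]
  rfl

theorem coeff_inverse (hK : (hilbertBasis s).IsDiagonal (fun k => (halfInteger k : ℂ)⁻¹) K)
    (f : TwistedSobolev s) (k : ℤ) :
    coeff s (K f) k = (halfInteger k : ℂ)⁻¹ * coeff s f k := by
  have h := hK f k
  rw [inner_hilbertBasis, inner_hilbertBasis, mul_left_comm] at h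
  have hne : ((twistedWeight k ^ (s / 2) : ℝ) : ℂ) ≠ 0 := by
    exact_mod_cast (Real.rpow_pos_of_pos (twistedWeight_pos k) _).ne'
  exact mul_left_cancel₀ hne h

theorem mem_domain_inverse (hK : (hilbertBasis s).IsDiagonal (fun k => (halfInteger k : ℂ)⁻¹) K)
    (f : TwistedSobolev s) : K f ∈ (twistedOperator s).domain := by
  change coeff s (K f) ∈ weightedEll2 (s + 1)
  refine Summable.of_nonneg_of_le (fun k => ?_) (fun k => ?_)
    ((mem_weightedEll2.mp (coeff_mem f)).mul_left 5)
  · exact mul_nonneg (Real.rpow_nonneg (twistedWeight_pos k).le _) (sq_nonneg _)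
  · have h0 := one_half_le_abs_halfInteger k
    -- The left side is `1 + |k + 1/2|⁻²`, and `|k + 1/2|⁻² ≤ 4`.
    have h1 : twistedWeight k * (|halfInteger k|⁻¹) ^ 2 ≤ 5 := by
      rw [inv_pow, ← div_eq_mul_inv, div_le_iff₀ (by positivity)]
      change 1 + |halfInteger k| ^ 2 ≤ _
      nlinarith
    rw [coeff_inverse hK, norm_mul, norm_inv, Complex.norm_real, Real.norm_eq_abs,
      Real.rpow_add (twistedWeight_pos k), Real.rpow_one, mul_pow]
    have h2 : 0 ≤ twistedWeight k ^ s * ‖coeff s f k‖ ^ 2 :=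
      mul_nonneg (Real.rpow_nonneg (twistedWeight_pos k).le _) (sq_nonneg _)
    nlinarith

theorem halfIntegerMul_apply (a : ℤ → ℂ) (k : ℤ) :
    halfIntegerMul a k = (halfInteger k : ℂ) * a k := by
  simp [halfIntegerMul, halfInteger]

theorem coeff_twistedOperator (f : (twistedOperator s).domain) (k : ℤ) :
    coeff s (twistedOperator s f) k = (halfInteger k : ℂ) * coeff s f k := by
  rw [← halfIntegerMul_apply]
  exact congrFun (coeff_ofCoeff _ (halfIntegerMul_mem f.2)) k

theorem isPerturbedInverse
    (hK : (hilbertBasis s).IsDiagonal (fun k => (halfInteger k : ℂ)⁻¹) K)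
    (B : TwistedSobolev s →L[ℂ] TwistedSobolev s) :
    IsPerturbedInverse K B (perturbedOperator s B) where
  mem_domain := mem_domain_inverse hK
  exists_eq x hx := by
    refine ⟨twistedOperator s ⟨x, hx⟩, coeff_injective (funext fun k => ?_)⟩
    rw [coeff_inverse hK, coeff_twistedOperator, inv_mul_cancel_left₀ (ofReal_halfInteger_ne_zero k)]
  apply y h := by
    change twistedOperator s ⟨K y, h⟩ + B (K y) = _
    congr 1
    refine coeff_injective (funext fun k => ?_)
    rw [coeff_twistedOperator, coeff_inverse hK,
      mul_inv_cancel_left₀ (ofReal_halfInteger_ne_zero k)]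

/-- The `l k` cannot accumulate at `μ`: all but finitely many are at distance at least `1`, and the
others attain a positive minimum. -/
theorem exists_lt_abs_sub {l : ℤ → ℝ} {C : ℝ} (hl : ∀ k, |l k - halfInteger k| ≤ C) {μ : ℝ}
    (hμ : ∀ k, l k ≠ μ) : ∃ r > 0, ∀ k, r ≤ |l k - μ| := by
  classical
  let F := (finite_abs_halfInteger_le (1 + C + |μ|)).toFinset
  obtain ⟨r, hr, hrF⟩ : ∃ r > 0, ∀ k ∈ F, r ≤ |l k - μ| := by
    rcases F.eq_empty_or_nonempty with h | h
    · exact ⟨1, one_pos, by simp [h]⟩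
    · obtain ⟨k, -, hmin⟩ := F.exists_min_image (fun k => |l k - μ|) h
      exact ⟨|l k - μ|, abs_pos.mpr (sub_ne_zero.mpr (hμ k)), hmin⟩
  refine ⟨min r 1, lt_min hr one_pos, fun k => ?_⟩
  by_cases hk : k ∈ F
  · exact (min_le_left _ _).trans (hrF k hk)
  · refine (min_le_right _ _).trans ?_
    simp only [F, Set.Finite.mem_toFinset, mem_ofPred_eq, not_le] at hk
    have h1 := hl k
    have h2 := abs_sub_abs_le_abs_sub (halfInteger k) (l k)
    have h3 := abs_sub_abs_le_abs_sub (l k) μ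
    rw [abs_sub_comm] at h2
    linarith

/-- The eigenvalues of a continuous family of perturbed operators admit a global continuous
labelling. -/
theorem exists_isEigenvalueLabelling (s : ℝ)
    (B : unitInterval → (TwistedSobolev s →L[ℂ] TwistedSobolev s))
    (hB_cont : Continuous B) (hB_sa : ∀ t, IsSelfAdjoint (B t)) :
    ∃ l : ℤ → unitInterval → ℝ, IsEigenvalueLabelling (fun t => perturbedOperator s (B t)) l := by
  obtain ⟨K, hK⟩ := exists_inverse s
  let e := hilbertBasis s
  have hKs := (isSelfAdjoint_inverse hK).isSymmetric
  let l : ℤ → unitInterval → ℝ := fun k t =>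
    e.limEigenvalue halfInteger halfInteger_monotone (hB_sa t) k
  have hbd : ∀ k t, |l k t - halfInteger k| ≤ ‖B t‖ := fun k t =>
    e.abs_limEigenvalue_sub_diag_le halfInteger halfInteger_monotone (hB_sa t) k
  choose v hv using fun t => e.exists_eigenbasis halfInteger halfInteger_monotone
    halfInteger_ne_zero finite_abs_halfInteger_le hK (isCompactOperator_inverse hK) (hB_sa t)
  have hT := fun t => isPerturbedInverse hK (B t)
  -- A bound uniform in `t` is needed because the finite set in `proper` must serve all times at
  -- once.
  obtain ⟨C, hC⟩ : ∃ C, ∀ t, ‖B t‖ ≤ C := by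
    obtain ⟨C, hC⟩ := (isCompact_range hB_cont).isBounded.exists_norm_le
    exact ⟨C, fun t => hC _ (mem_range_self t)⟩
  refine ⟨l, fun k => ?_, fun r => ?_, fun t μ => ⟨fun h k hk => ?_, fun h => ?_⟩,
    fun t μ S hS => ?_⟩
  · rw [continuous_iff_continuousAt]
    intro t
    refine tendsto_iff_norm_sub_tendsto_zero.mpr (squeeze_zero (fun _ => norm_nonneg _)
      (fun τ => e.abs_limEigenvalue_sub_le halfInteger halfInteger_monotone (hB_sa τ) (hB_sa t) k)
      (tendsto_iff_norm_sub_tendsto_zero.mp (hB_cont.tendsto t)))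
  · refine ⟨(finite_abs_halfInteger_le (r + C)).toFinset, fun k hk t => ?_⟩
    simp only [Set.Finite.mem_toFinset, mem_ofPred_eq, not_le] at hk
    have h1 := (hbd k t).trans (hC t)
    have h2 := abs_sub_abs_le_abs_sub (halfInteger k) (l k t)
    rw [abs_sub_comm] at h2
    linarith
  · exact (hT t).ne_of_mem_unboundedResolventSet (hv t) h k (by exact_mod_cast hk)
  · obtain ⟨r, hr, hrl⟩ := exists_lt_abs_sub (fun k => hbd k t) h
    refine (hT t).mem_unboundedResolventSet hKs (hB_sa t).isSymmetric (hv t) hr fun k => ?_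
    rw [← Complex.ofReal_sub, Complex.norm_real]
    exact hrl k
  · exact (hT t).rank_unboundedEigenspace hKs (hB_sa t).isSymmetric (hv t) μ S hS

theorem isSelfAdjoint_perturbedOperator {B : TwistedSobolev s →L[ℂ] TwistedSobolev s}
    (hB : IsSelfAdjoint B) : IsSelfAdjoint (perturbedOperator s B) := by
  obtain ⟨K, hK⟩ := exists_inverse s
  exact (isPerturbedInverse hK B).isSelfAdjoint (isSelfAdjoint_inverse hK)
    (denseRange_inverse hK) hB

theorem isCompactOperator_of_isResolventAt {B : TwistedSobolev s →L[ℂ] TwistedSobolev s} {z : ℂ}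
    {R : TwistedSobolev s →L[ℂ] TwistedSobolev s}
    (hR : IsResolventAt (perturbedOperator s B) z R) : IsCompactOperator R := by
  obtain ⟨K, hK⟩ := exists_inverse s
  exact (isPerturbedInverse hK B).isCompactOperator_of_isResolventAt
    (isCompactOperator_inverse hK) hR

end TwistedSobolev

end

/-! ### Well-definedness of the spectral flow -/

theorem theorem7p3 (s : ℝ)
    (B : unitInterval → (TwistedSobolev s →L[ℂ] TwistedSobolev s))
    (hB_cont : Continuous B) (hB_sa : ∀ t, IsSelfAdjoint (B t)) :
    (∀ t, IsSelfAdjoint (perturbedOperator s (B t)) ∧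
      HasCompactResolvent (perturbedOperator s (B t))) ∧
    Nonempty (SpectralGrid fun t => perturbedOperator s (B t)) ∧
    (∀ G : SpectralGrid fun t => perturbedOperator s (B t), Nonempty (EigenvalueBranches G)) ∧
    ∃! n : ℤ, ∀ (G : SpectralGrid fun t => perturbedOperator s (B t))
      (b : EigenvalueBranches G), b.signedCount = n := by
  obtain ⟨l, hl⟩ := TwistedSobolev.exists_isEigenvalueLabelling s B hB_cont hB_sa
  obtain ⟨G₀⟩ := hl.nonempty_spectralGrid
  obtain ⟨b₀⟩ := hl.nonempty_eigenvalueBranches G₀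
  refine ⟨fun t => ⟨TwistedSobolev.isSelfAdjoint_perturbedOperator (hB_sa t), ?_,
    fun z R hR => TwistedSobolev.isCompactOperator_of_isResolventAt hR⟩, ⟨G₀⟩,
    hl.nonempty_eigenvalueBranches, _, fun G b => hl.signedCount_eq_finsum b,
    fun n hn => (hn G₀ b₀).symm.trans (hl.signedCount_eq_finsum b₀)⟩
  -- A free level is a real point of the resolvent set, which is thus nonempty.
  obtain ⟨ε, hε, h⟩ := hl.exists_gap t
  exact ⟨_, ((hl.gap_iff hε t).mpr h).1⟩
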